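/- Let $n\ge 2$ and $\varepsilon\in\{1,-1\}$. Let $\langle x,y\rangle=x_1y_1+\cdots+x_ny_n+\varepsilon x_{n+1}y_{n+1}$ on $\mathbb R^{n+1}$, and let $M$ be the sphere $S^n=\{\langle x,x\rangle=1\}$ if $\varepsilon=1$, and hyperbolic space $H^n=\{\langle x,x\rangle=-1,\ x_{n+1}>0\}$ if $\varepsilon=-1$, with the induced Riemannian metric and its Levi-Civita connection $\nabla$. For a smooth vector field $\sigma$ on $M$ put $F=\tfrac12|\sigma|^2$, and write $\nabla^*\nabla\sigma=-\operatorname{tr}\nabla^2\sigma$ and $\Delta F=-\operatorname{div}\nabla F$. For $p,q\in\mathbb R$, $\sigma$ is called $(p,q)$-harmonic if $$(1+|\sigma|^2)\nabla^*\nabla\sigma+2p\,\nabla_{\nabla F}\sigma=\bigl(p|\nabla\sigma|^2-pq|\nabla F|^2-q(1+|\sigma|^2)\Delta F\bigr)\sigma$$ on $M$ (the Euler–Lagrange equation for harmonic sections of $TM$ with respect to the generalised Cheeger–Gromoll metric $h_{p,q}$), and harmonic if it is $(p,q)$-harmonic for some $(p,q)$. Two vector fields are congruent if an isometry of $M$ carries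 one to the other. For a positive integer $r$ with $2r<n+1$ let $\Sigma_r$ be the generalised Hopf field $$\Sigma_r(x)=(-x_2,x_1,\dots,-x_{2r},x_{2r-1},0,\dots,0).$$ Call $r$ admissible if $0<r<(n+1)/2$ and, when $\varepsilon=1$, also $r>1$. **Theorem.** For every admissible $r$ the twist equation $$2ck\,\omega^4+\varepsilon(2nk-c)\,\omega^2+1-n=0,\qquad c=n+1-2r,\quad k=r-1,$$ has precisely one positive root $\omega_0=\omega_0(n,r,\varepsilon)$. Let $\sigma$ be a Killing field of non-constant length on $M$. Then $\sigma$ is harmonic if and only if $\sigma$ is congruent to $\omega_0\Sigma_r$ for some admissible $r$. Furthermore, if $\sigma$ is congruent to $\omega_0\Sigma_r$ with $r$ admissible, then $\sigma$ is metrically unique: it is $(p,q)$-harmonic if and only if $p=n+1$ and $$q=\begin{cases}(1-n)/2,& r=1,\\[2pt] 2(1-r)\dfrac{\omega_0^2}{\omega_0^2+\varepsilon},& r>1.\end{cases}$$ -/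

import Mathlib

open scoped ContDiff

noncomputable section

namespace SpaceForm

/-- The ambient vector space `ℝⁿ⁺¹`. Its last coordinate is the timelike one in the
hyperbolic case. -/
abbrev Ambient (n : ℕ) : Type := EuclideanSpace ℝ (Fin (n + 1))

variable {n : ℕ}

/-- The diagonal entries `(1, …, 1, ε)` of the ambient inner product. -/
def signature (ε : ℝ) (i : Fin (n + 1)) : ℝ := if i = Fin.last n then ε else 1

/-- The ambient inner product `⟨x, y⟩ = x₁y₁ + ⋯ + xₙyₙ + ε xₙ₊₁yₙ₊₁`: Euclidean for `ε = 1`,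
Lorentzian for `ε = -1`. -/
def form (ε : ℝ) (x y : Ambient n) : ℝ := ∑ i, signature ε i * (x i * y i)

/-- The space form: the unit sphere `Sⁿ` for `ε = 1`, and the upper sheet
`{⟨x, x⟩ = -1, xₙ₊₁ > 0}` of the hyperboloid, i.e. hyperbolic space `Hⁿ`, for `ε = -1`. -/
def space (ε : ℝ) (n : ℕ) : Set (Ambient n) :=
  {x | form ε x x = ε ∧ (ε = -1 → 0 < x (Fin.last n))}

/-- The tangent space of the space form at `x`, as a set of ambient vectors. -/
def tangentSpace (ε : ℝ) (x : Ambient n) : Set (Ambient n) := {X | form ε x X = 0}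

/-- The orthogonal projection `X ↦ X - ε ⟨X, x⟩ x` of the ambient space onto the tangent space
at a point `x` of the space form. -/
def proj (ε : ℝ) (x X : Ambient n) : Ambient n := X - (ε * form ε X x) • x

/-- The radial retraction `y ↦ y / |y|` of a neighbourhood of the space form onto it. -/
def radial (ε : ℝ) (y : Ambient n) : Ambient n := (√(ε * form ε y y))⁻¹ • y

variable {E : Type*} [NormedAddCommGroup E] [NormedSpace ℝ E]

/- Functions, maps and vector fields on the space form are represented by functions on the ambient
space, of which only the values on the space form matter: near the space form they are replaced by
their radial extension. -/

/-- `f` is smooth on the space form: its radial extension is smooth at every point of it. -/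
def IsSmooth (ε : ℝ) (f : Ambient n → E) : Prop :=
  ∀ x ∈ space ε n, ContDiffAt ℝ ∞ (fun y => f (radial ε y)) x

/-- The derivative `D_X f` at the point `x` of the space form, for `X` tangent at `x`; it is
computed from the radial extension of `f`, but any other smooth local extension of `f` gives the
same value on tangent vectors. -/
def dirDeriv (ε : ℝ) (f : Ambient n → E) (x X : Ambient n) : E :=
  fderiv ℝ (fun y => f (radial ε y)) x X

/-- The Levi-Civita covariant derivative `(∇_X σ)(x)` of the induced metric: the tangential part
of `D_X σ`. For a tangent field `σ` this is the Gauss formula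
`∇_X σ = D_X σ + ε ⟨X, σ⟩ x`. -/
def cov (ε : ℝ) (σ : Ambient n → Ambient n) (x X : Ambient n) : Ambient n :=
  proj ε x (dirDeriv ε σ x X)

/-- The second covariant derivative `∇²_{X,Y} σ = ∇_X (∇_Y σ) - ∇_{∇_X Y} σ` at `x`, where the
tangent vector `Y` at `x` is extended to the vector field `y ↦ proj y Y`. -/
def cov₂ (ε : ℝ) (σ : Ambient n → Ambient n) (x X Y : Ambient n) : Ambient n :=
  cov ε (fun y => cov ε σ y (proj ε y Y)) x X - cov ε σ x (cov ε (fun y => proj ε y Y) x X)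

/-- The trace `∑ᵢ B(Eᵢ, Eᵢ)` over an orthonormal basis `E₁, …, Eₙ` of the tangent space at `x` of
a bilinear map `B` on that tangent space. It is the same for all such bases (see
`tangentTrace_eq_sum`) and is computed here from the standard basis `eᵢ` of the ambient space: if
`π` is the tangential projection then it is the trace `∑ᵢ ⟨eᵢ, eᵢ⟩ B(π eᵢ, π eᵢ)` of the extension
of `B` by zero on the normal line. -/
def tangentTrace (ε : ℝ) (x : Ambient n) (B : Ambient n → Ambient n → E) : E :=
  ∑ i, signature ε i •
    B (proj ε x (EuclideanSpace.single i 1)) (proj ε x (EuclideanSpace.single i 1))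

/-- The rough Laplacian `∇*∇σ = -∑ᵢ ∇²_{Eᵢ,Eᵢ} σ`. -/
def roughLaplacian (ε : ℝ) (σ : Ambient n → Ambient n) (x : Ambient n) : Ambient n :=
  -tangentTrace ε x (fun X Y => cov₂ ε σ x X Y)

/-- The gradient `∇f = ∑ᵢ (D_{Eᵢ} f) Eᵢ`. -/
def grad (ε : ℝ) (f : Ambient n → ℝ) (x : Ambient n) : Ambient n :=
  tangentTrace ε x (fun X Y => dirDeriv ε f x X • Y)

/-- The divergence `div σ = ∑ᵢ ⟨∇_{Eᵢ} σ, Eᵢ⟩`. -/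
def divergence (ε : ℝ) (σ : Ambient n → Ambient n) (x : Ambient n) : ℝ :=
  tangentTrace ε x (fun X Y => form ε (cov ε σ x X) Y)

/-- The (positive) Laplacian `Δf = -div ∇f` on functions. -/
def laplacian (ε : ℝ) (f : Ambient n → ℝ) (x : Ambient n) : ℝ := -divergence ε (grad ε f) x

/-- The squared length `|σ|²`. -/
def lengthSq (ε : ℝ) (σ : Ambient n → Ambient n) (x : Ambient n) : ℝ := form ε (σ x) (σ x)

/-- The squared norm `|∇σ|² = ∑ᵢ |∇_{Eᵢ} σ|²`. -/
def covNormSq (ε : ℝ) (σ : Ambient n → Ambient n) (x : Ambient n) : ℝ :=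
  tangentTrace ε x (fun X Y => form ε (cov ε σ x X) (cov ε σ x Y))

/-- The function `F = |σ|² / 2`. -/
def halfLengthSq (ε : ℝ) (σ : Ambient n → Ambient n) (x : Ambient n) : ℝ := lengthSq ε σ x / 2

/-- `T_p(σ) = (1 + |σ|²) ∇*∇σ + 2p ∇_{∇F} σ`. -/
def tensionT (ε p : ℝ) (σ : Ambient n → Ambient n) (x : Ambient n) : Ambient n :=
  (1 + lengthSq ε σ x) • roughLaplacian ε σ x +
    (2 * p) • cov ε σ x (grad ε (halfLengthSq ε σ) x)

/-- `φ_{p,q}(σ) = p |∇σ|² - p q |∇F|² - q (1 + |σ|²) ΔF`. -/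
def tensionPhi (ε p q : ℝ) (σ : Ambient n → Ambient n) (x : Ambient n) : ℝ :=
  p * covNormSq ε σ x - p * q * lengthSq ε (grad ε (halfLengthSq ε σ)) x -
    q * (1 + lengthSq ε σ x) * laplacian ε (halfLengthSq ε σ) x

/-- The smooth vector field `σ` is `(p, q)`-harmonic: `τ_{p,q}(σ) = T_p(σ) - φ_{p,q}(σ) σ = 0`, the
Euler-Lagrange equation for harmonic sections of the tangent bundle with respect to the generalised
Cheeger-Gromoll metric with parameters `(p, q)`. -/
def IsPQHarmonic (ε p q : ℝ) (σ : Ambient n → Ambient n) : Prop :=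
  ∀ x ∈ space ε n, tensionT ε p σ x - tensionPhi ε p q σ x • σ x = 0

/-- `σ` is a harmonic vector field: `(p, q)`-harmonic for some metric parameters `(p, q)`. -/
def IsHarmonic (ε : ℝ) (σ : Ambient n → Ambient n) : Prop := ∃ p q : ℝ, IsPQHarmonic ε p q σ

/-- `σ` is a smooth (tangent) vector field on the space form. -/
structure IsVectorField (ε : ℝ) (σ : Ambient n → Ambient n) : Prop where
  smooth : IsSmooth ε σ
  tangent : ∀ x ∈ space ε n, σ x ∈ tangentSpace ε x

/-- `σ` is a Killing field: `⟨∇_X σ, Y⟩ + ⟨X, ∇_Y σ⟩ = 0` for all tangent vectors `X`, `Y`. -/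
structure IsKilling (ε : ℝ) (σ : Ambient n → Ambient n) : Prop extends IsVectorField ε σ where
  killing : ∀ x ∈ space ε n, ∀ X ∈ tangentSpace ε x, ∀ Y ∈ tangentSpace ε x,
    form ε (cov ε σ x X) Y + form ε X (cov ε σ x Y) = 0

/-- `σ` has constant length on the space form. -/
def HasConstantLength (ε : ℝ) (σ : Ambient n → Ambient n) : Prop :=
  ∃ c : ℝ, ∀ x ∈ space ε n, lengthSq ε σ x = c

/-- `φ` is an isometry of the space form: a smooth bijection whose differential preserves the
metric (so that its inverse is smooth as well). -/
structure IsIsometry (ε : ℝ) (φ : Ambient n → Ambient n) : Prop where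
  bijOn : Set.BijOn φ (space ε n) (space ε n)
  smooth : IsSmooth ε φ
  metric : ∀ x ∈ space ε n, ∀ X ∈ tangentSpace ε x, ∀ Y ∈ tangentSpace ε x,
    form ε (dirDeriv ε φ x X) (dirDeriv ε φ x Y) = form ε X Y

/-- The vector fields `σ` and `σ'` are congruent: `dφ(σ) = σ' ∘ φ` for an isometry `φ`. -/
def AreCongruent (ε : ℝ) (σ σ' : Ambient n → Ambient n) : Prop :=
  ∃ φ : Ambient n → Ambient n, IsIsometry ε φ ∧
    ∀ x ∈ space ε n, dirDeriv ε φ x (σ x) = σ' (φ x)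

/-- The generalised Hopf field `Σ_r(x) = (-x₂, x₁, …, -x₂ᵣ, x₂ᵣ₋₁, 0, …, 0)`. With coordinates
numbered from `0`, entry `i < 2r` is `-x_{i+1}` for even `i` and `x_{i-1}` for odd `i`; all indices
that occur are in range when `2r ≤ n + 1`. -/
def hopfField (r : ℕ) (x : Ambient n) : Ambient n :=
  WithLp.toLp 2 fun i : Fin (n + 1) =>
    if i.val < 2 * r then
      if Even i.val then (if h : i.val + 1 < n + 1 then -x ⟨i.val + 1, h⟩ else 0)
      else x ⟨i.val - 1, lt_of_le_of_lt (Nat.sub_le _ _) i.isLt⟩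
    else 0

/-- The ranks that occur: `0 < r < (n + 1) / 2`, with `r > 1` on the sphere. -/
def IsAdmissibleRank (ε : ℝ) (n r : ℕ) : Prop := 0 < r ∧ 2 * r < n + 1 ∧ (ε = 1 → 1 < r)

/-- `w` is a positive root of the twist equation
`2ckw⁴ + ε(2nk - c)w² + 1 - n = 0`, where `c = n + 1 - 2r` and `k = r - 1`. -/
def IsOptimalTwist (ε : ℝ) (n r : ℕ) (w : ℝ) : Prop :=
  0 < w ∧
    2 * ((n : ℝ) + 1 - 2 * r) * ((r : ℝ) - 1) * w ^ 4 +
      ε * (2 * n * ((r : ℝ) - 1) - ((n : ℝ) + 1 - 2 * r)) * w ^ 2 + 1 - n = 0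

/-- The metric parameter `q`: it is `(1 - n)/2` for `r = 1`, and `2(1 - r) w² / (w² + ε)` for
`r > 1`. -/
def metricParameterQ (ε : ℝ) (n r : ℕ) (w : ℝ) : ℝ :=
  if r = 1 then (1 - (n : ℝ)) / 2 else 2 * (1 - (r : ℝ)) * (w ^ 2 / (w ^ 2 + ε))

theorem signature_mul_self {ε : ℝ} (hε : ε = 1 ∨ ε = -1) (i : Fin (n + 1)) :
    signature ε i * signature ε i = 1 := by
  unfold signature
  split_ifs
  · rcases hε with rfl | rfl <;> norm_num
  · norm_num

/-- The sum over any orthonormal basis of the tangent space computes `tangentTrace`. -/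
theorem tangentTrace_eq_sum {ε : ℝ} (hε : ε = 1 ∨ ε = -1) {x : Ambient n} (hx : x ∈ space ε n)
    (B : Ambient n →ₗ[ℝ] Ambient n →ₗ[ℝ] E) (b : Fin n → Ambient n)
    (hb : ∀ i, b i ∈ tangentSpace ε x)
    (ho : ∀ i j, form ε (b i) (b j) = if i = j then 1 else 0) :
    tangentTrace ε x (fun X Y => B X Y) = ∑ j, B (b j) (b j) := by
  have hεε : ε * ε = 1 := by rcases hε with rfl | rfl <;> norm_num
  have hcomm : ∀ u v : Ambient n, form ε u v = form ε v u := fun u v => by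
    simp only [form, mul_comm (u _) (v _)]
  let f : Fin (n + 1) → Ambient n := Fin.lastCases x b
  have hfc : ∀ i : Fin n, f i.castSucc = b i := fun i => by simp [f]
  have hfl : f (Fin.last n) = x := by simp [f]
  have hf : ∀ i j, form ε (f i) (f j) = if i = j then signature ε i else 0 := by
    intro i j
    induction i using Fin.lastCases with
    | last =>
      induction j using Fin.lastCases with
      | last => simpa [hfl, signature] using hx.1
      | cast j =>
        rw [hfl, hfc, if_neg (Fin.castSucc_lt_last j).ne']
        exact hb j
    | cast i =>
      induction j using Fin.lastCases with
      | last =>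
        rw [hfl, hfc, if_neg (Fin.castSucc_lt_last i).ne, hcomm]
        exact hb i
      | cast j => simp [hfc, ho, signature, (Fin.castSucc_lt_last i).ne]
  let M : Matrix (Fin (n + 1)) (Fin (n + 1)) ℝ := Matrix.of fun i a => f i a
  let N : Matrix (Fin (n + 1)) (Fin (n + 1)) ℝ :=
    Matrix.of fun a i => signature ε a * f i a * signature ε i
  have hMN : M * N = 1 := by
    ext i j
    have h1 : (M * N) i j = form ε (f i) (f j) * signature ε j := by
      simp only [Matrix.mul_apply, M, N, Matrix.of_apply, form, Finset.sum_mul]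
      exact Finset.sum_congr rfl fun a _ => by ring
    rw [h1, hf, Matrix.one_apply]
    split_ifs with h
    · rw [h, signature_mul_self hε]
    · simp
  have hNM : N * M = 1 := mul_eq_one_comm.mp hMN
  have key : ∀ a c : Fin (n + 1), ∑ i, signature ε i * (f i a * f i c) =
      if a = c then signature ε a else 0 := by
    intro a c
    have h1 := congrFun (congrFun hNM a) c
    simp only [Matrix.mul_apply, M, N, Matrix.of_apply, Matrix.one_apply] at h1
    have h2 := congrArg (fun t => signature ε a * t) h1
    simp only [Finset.mul_sum] at h2
    calc ∑ i, signature ε i * (f i a * f i c)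
        = ∑ i, signature ε a * (signature ε a * f i a * signature ε i * f i c) := by
          refine Finset.sum_congr rfl fun i _ => ?_
          linear_combination (-(signature ε i * f i a * f i c)) * signature_mul_self hε a
      _ = _ := by rw [h2]; split_ifs <;> simp
  let P : Ambient n →ₗ[ℝ] Ambient n :=
    { toFun := fun X => proj ε x X
      map_add' := fun X Y => by
        have : form ε (X + Y) x = form ε X x + form ε Y x := by
          simp only [form, ← Finset.sum_add_distrib]
          exact Finset.sum_congr rfl fun a _ => by simp; ring
        simp only [proj, this, mul_add, add_smul]; abel
      map_smul' := fun r X => by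
        have : form ε (r • X) x = r * form ε X x := by
          simp only [form, Finset.mul_sum]
          exact Finset.sum_congr rfl fun a _ => by simp; ring
        simp only [proj, this, RingHom.id_apply, smul_sub, smul_smul]
        ring_nf }
  have hPx : P x = 0 := by
    change x - (ε * form ε x x) • x = 0
    rw [hx.1, hεε]; simp
  have hPb : ∀ i, P (b i) = b i := fun i => by
    change b i - (ε * form ε (b i) x) • x = b i
    rw [hcomm, show form ε x (b i) = 0 from hb i]; simp
  have hexp : ∀ v : Ambient n, v = ∑ a, v a • EuclideanSpace.single a (1 : ℝ) := fun v => by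
    ext c; simp [Finset.sum_apply, Pi.single_apply]
  have hB : ∀ v : Ambient n, B (P v) (P v) = ∑ a, ∑ c, (v a * v c) •
      B (P (EuclideanSpace.single a (1 : ℝ))) (P (EuclideanSpace.single c (1 : ℝ))) := fun v => by
    conv_lhs => rw [hexp v]
    simp only [map_sum, map_smul, LinearMap.sum_apply, LinearMap.smul_apply, Finset.smul_sum,
      smul_smul]
    rw [Finset.sum_comm]
    exact Finset.sum_congr rfl fun a _ => Finset.sum_congr rfl fun c _ => by rw [mul_comm]
  have hS : ∑ i, signature ε i • B (P (f i)) (P (f i)) = ∑ j, B (b j) (b j) := by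
    rw [Fin.sum_univ_castSucc, hfl, hPx]
    simp [hfc, hPb, signature, (Fin.castSucc_lt_last _).ne]
  rw [← hS]
  simp only [hB, Finset.smul_sum, smul_smul]
  rw [Finset.sum_comm]
  change ∑ a, signature ε a • B (P (EuclideanSpace.single a 1)) (P (EuclideanSpace.single a 1)) = _
  refine Finset.sum_congr rfl fun a _ => ?_
  rw [Finset.sum_comm]
  simp only [← Finset.sum_smul, key]
  simp

/-- `dirDeriv` is the ordinary directional derivative of any differentiable local extension. -/
theorem dirDeriv_eq_fderiv {ε : ℝ} (hε : ε = 1 ∨ ε = -1) {x : Ambient n} (hx : x ∈ space ε n)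
    {f g : Ambient n → E} (hg : DifferentiableAt ℝ g x) (hfg : ∀ y ∈ space ε n, f y = g y)
    {X : Ambient n} (hX : X ∈ tangentSpace ε x) : dirDeriv ε f x X = fderiv ℝ g x X := by
  have hεε : ε * ε = 1 := by rcases hε with rfl | rfl <;> norm_num
  have hdiff : Differentiable ℝ fun y : Ambient n => ε * form ε y y := by
    unfold form; fun_prop
  have hx1 : ε * form ε x x = 1 := by rw [hx.1, hεε]
  have hpos : ∀ᶠ y in nhds x, 0 < ε * form ε y y :=
    hdiff.continuous.continuousAt.eventually (lt_mem_nhds (by simp only [hx1]; norm_num))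
  have hlast : ∀ᶠ y : Ambient n in nhds x, ε = -1 → 0 < y (Fin.last n) := by
    by_cases h : ε = -1
    · have hc : Continuous fun y : Ambient n => y (Fin.last n) := by fun_prop
      filter_upwards [hc.continuousAt.eventually (lt_mem_nhds (hx.2 h))] with y hy _ using hy
    · exact Filter.Eventually.of_forall fun y h' => absurd h' h
  have hform : ∀ (r : ℝ) (y : Ambient n), form ε (r • y) (r • y) = r ^ 2 * form ε y y := by
    intro r y
    simp only [form, Finset.mul_sum]
    exact Finset.sum_congr rfl fun a _ => by simp; ring
  have hmem : ∀ᶠ y in nhds x, radial ε y ∈ space ε n := by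
    filter_upwards [hpos, hlast] with y hy hy'
    refine ⟨?_, fun h => ?_⟩
    · rw [radial, hform, inv_pow, Real.sq_sqrt hy.le]
      have : form ε y y ≠ 0 := fun h => by simp [h] at hy
      have : ε ≠ 0 := fun h => by simp [h] at hy
      field_simp
      rw [pow_two, hεε]
    · simp only [radial, PiLp.smul_apply, smul_eq_mul]
      exact mul_pos (inv_pos.mpr (Real.sqrt_pos.mpr hy)) (hy' h)
  have hrx : radial ε x = x := by simp [radial, hx1]
  have hq : HasFDerivAt (fun y : Ambient n => ε * form ε y y)
      (fderiv ℝ (fun y : Ambient n => ε * form ε y y) x) x := hdiff.differentiableAt.hasFDerivAt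
  have hqX : fderiv ℝ (fun y : Ambient n => ε * form ε y y) x X = 0 := by
    have hi : ∀ a : Fin (n + 1), HasFDerivAt (fun y : Ambient n => y a)
        (EuclideanSpace.proj a : Ambient n →L[ℝ] ℝ) x :=
      fun a => (EuclideanSpace.proj a : Ambient n →L[ℝ] ℝ).hasFDerivAt
    have h1 := (HasFDerivAt.fun_sum (u := Finset.univ) fun a _ =>
      ((hi a).mul (hi a)).const_mul (signature ε a)).const_mul ε
    have h2 : fderiv ℝ (fun y : Ambient n => ε * form ε y y) x = _ := h1.fderiv
    rw [h2]
    have h3 : form ε x X = 0 := hX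
    have h4 : ∑ a, signature ε a * (x a * X a + x a * X a) = 2 * form ε x X := by
      simp only [form, Finset.mul_sum]
      exact Finset.sum_congr rfl fun a _ => by ring
    simp only [smul_apply, sum_apply, add_apply, smul_eq_mul]
    change ε * ∑ a, signature ε a * (x a * X a + x a * X a) = 0
    rw [h4, h3]; ring
  have hinv := (hasDerivAt_inv (x := √(ε * form ε x x)) (by rw [hx1]; norm_num)).comp_hasFDerivAt x
    (hq.sqrt (by rw [hx1]; norm_num))
  have hr := hinv.smul (hasFDerivAt_id x)
  have hrX : fderiv ℝ (radial ε) x X = X := by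
    have h2 : fderiv ℝ (radial ε) x = _ := hr.fderiv
    rw [h2]
    simp [hqX, hx1]
  have hrd : DifferentiableAt ℝ (radial ε : Ambient n → Ambient n) x := hr.differentiableAt
  have hEq : (fun y => f (radial ε y)) =ᶠ[nhds x] g ∘ radial ε := by
    filter_upwards [hmem] with y hy using hfg _ hy
  rw [dirDeriv, hEq.fderiv_eq, fderiv_comp x (by rwa [hrx]) hrd]
  simp [hrX, hrx]

/-- For `ε = 1` the space form is the unit sphere. -/
theorem space_one : space 1 n = Metric.sphere (0 : Ambient n) 1 := by
  ext x
  have : form 1 x x = ‖x‖ ^ 2 := by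
    rw [EuclideanSpace.norm_sq_eq]
    simp [form, signature, pow_two]
  simp only [space, Set.mem_ofPred_eq, this, mem_sphere_zero_iff_norm]
  constructor
  · rintro ⟨h, -⟩
    nlinarith [norm_nonneg x]
  · intro h
    rw [h]; norm_num

end SpaceForm

end

open SpaceForm

open scoped ContDiff

noncomputable section

namespace SpaceForm

variable {n : ℕ} {E : Type*} [NormedAddCommGroup E] [NormedSpace ℝ E]

/-! ### The ambient bilinear form -/

/-! A Killing field on M is the restriction of a skew endomorphism A of the ambient space: its
extension to the cone over M, homogeneous of degree one, is an infinitesimal isometry of a flat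
space and so has constant differential (`IsKilling.exists_linear`). The same rigidity makes
isometries linear. With σ(x) = Ax every term of the Euler–Lagrange equation is explicit: ∇*∇σ =
ε(n-1)σ, ∇F = -A²x - ε|σ|²x, while |∇σ|² and ΔF are affine in |σ|² with constant terms given by tr
A². The equation takes the form scalar · Ax = 2p A³x (`tension_linear`).

For non-constant length p = 0 is impossible, so A³x is proportional to Ax at every point, and A²
acts on the range of A as one scalar μ (`exists_cubic`). What remains is σ times a quadratic
polynomial in |σ|². As M is connected, |σ|² takes infinitely many values, so the coefficients
vanish: three scalar equations in p, q, μ and tr A² (`isPQHarmonic_iff`). They force q ≠ 0 and p =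
n+1.

Signs exclude μ ≥ 0 (`eigenvalue_neg`). For μ = -w², projection to ker A produces a zero of σ on M
(`exists_zero_of_elliptic`). The range of A is tangent to M at that zero, hence spacelike, and A/w
is an orthogonal complex structure on it; a unitary basis makes σ congruent to wΣ_r with 2r = rank A
(`exists_areCongruent`). Then tr A² = -2rw², and eliminating q leaves the twist equation.
Conversely, congruence preserves μ and tr A², and under the twist equation the three equations have
exactly one solution (p, q) (`coeff_equations_iff`). The twist equation is quadratic in w², and the
signs of its coefficients leave one positive root (`existsUnique_pos_root`). -/

theorem form_comm (ε : ℝ) (x y : Ambient n) : form ε x y = form ε y x := by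
  simp only [form, mul_comm (x _)]

@[simp] theorem form_add_left (ε : ℝ) (x y z : Ambient n) :
    form ε (x + y) z = form ε x z + form ε y z := by
  simp only [form, ← Finset.sum_add_distrib]
  exact Finset.sum_congr rfl fun a _ => by simp; ring

@[simp] theorem form_smul_left (ε c : ℝ) (x z : Ambient n) :
    form ε (c • x) z = c * form ε x z := by
  simp only [form, Finset.mul_sum]
  exact Finset.sum_congr rfl fun a _ => by simp; ring

/-- The ambient inner product as a continuous bilinear map. -/
def formL (ε : ℝ) (n : ℕ) : Ambient n →L[ℝ] Ambient n →L[ℝ] ℝ :=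
  (LinearMap.mk₂ ℝ (form ε) (form_add_left ε) (form_smul_left ε)
    (fun x y z => by rw [form_comm, form_add_left, form_comm, form_comm ε z])
    (fun c x y => by
      rw [form_comm, form_smul_left, form_comm, smul_eq_mul])).toContinuousBilinearMap

theorem formL_apply (ε : ℝ) (x y : Ambient n) : formL ε n x y = form ε x y := rfl

@[simp] theorem form_add_right (ε : ℝ) (x y z : Ambient n) :
    form ε x (y + z) = form ε x y + form ε x z := (formL ε n x).map_add y z

@[simp] theorem form_smul_right (ε c : ℝ) (x y : Ambient n) :
    form ε x (c • y) = c * form ε x y := (formL ε n x).map_smul c y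

@[simp] theorem form_zero_right (ε : ℝ) (x : Ambient n) : form ε x 0 = 0 := (formL ε n x).map_zero

@[simp] theorem form_zero_left (ε : ℝ) (x : Ambient n) : form ε 0 x = 0 := by
  rw [form_comm, form_zero_right]

@[simp] theorem form_neg_right (ε : ℝ) (x y : Ambient n) : form ε x (-y) = -form ε x y :=
  (formL ε n x).map_neg y

@[simp] theorem form_neg_left (ε : ℝ) (x y : Ambient n) : form ε (-x) y = -form ε x y := by
  rw [form_comm, form_neg_right, form_comm]

@[simp] theorem form_sub_right (ε : ℝ) (x y z : Ambient n) :
    form ε x (y - z) = form ε x y - form ε x z := (formL ε n x).map_sub y z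

@[simp] theorem form_sub_left (ε : ℝ) (x y z : Ambient n) :
    form ε (x - y) z = form ε x z - form ε y z := by
  rw [form_comm, form_sub_right, form_comm, form_comm ε z]

theorem form_sum_left {ι : Type*} (s : Finset ι) (ε : ℝ) (f : ι → Ambient n) (y : Ambient n) :
    form ε (∑ i ∈ s, f i) y = ∑ i ∈ s, form ε (f i) y := by
  induction s using Finset.cons_induction with
  | empty => simp
  | cons a s h ih => simp [Finset.sum_cons, ih]

theorem form_sum_right {ι : Type*} (s : Finset ι) (ε : ℝ) (f : ι → Ambient n) (y : Ambient n) :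
    form ε y (∑ i ∈ s, f i) = ∑ i ∈ s, form ε y (f i) := by
  simp only [form_comm ε y, form_sum_left]

theorem form_single (ε : ℝ) (x : Ambient n) (i : Fin (n + 1)) :
    form ε x (EuclideanSpace.single i 1) = signature ε i * x i := by
  simp [form]

theorem eq_zero_of_form {ε : ℝ} (hε : ε = 1 ∨ ε = -1) {x : Ambient n}
    (h : ∀ y, form ε x y = 0) : x = 0 := by
  ext i
  have h1 := h (EuclideanSpace.single i 1)
  rw [form_single] at h1
  have h2 := signature_mul_self hε i
  have : x i = signature ε i * (signature ε i * x i) := by rw [← mul_assoc, h2, one_mul]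
  rw [this, h1]; simp

theorem sq_eq_one {ε : ℝ} (hε : ε = 1 ∨ ε = -1) : ε * ε = 1 := by
  rcases hε with rfl | rfl <;> norm_num

theorem hasFDerivAt_form (ε : ℝ) {f g : E → Ambient n} {f' g' : E →L[ℝ] Ambient n} {x : E}
    (hf : HasFDerivAt f f' x) (hg : HasFDerivAt g g' x) :
    HasFDerivAt (fun y => form ε (f y) (g y))
      ((formL ε n (f x)).comp g' + ((formL ε n).flip (g x)).comp f') x :=
  (formL ε n).hasFDerivAt_of_bilinear hf hg

/-- A nonzero vector without last coordinate has positive square. -/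
theorem form_self_pos_of_last {ε : ℝ} {v : Ambient n} (h : v (Fin.last n) = 0)
    (hv : v ≠ 0) : 0 < form ε v v := by
  have h1 : form ε v v = ‖v‖ ^ 2 := by
    rw [EuclideanSpace.norm_sq_eq, form]
    refine Finset.sum_congr rfl fun i _ => ?_
    unfold signature
    split_ifs with hi
    · subst hi; simp [h]
    · simp [pow_two]
  rw [h1]
  have := norm_pos_iff.mpr hv
  positivity

theorem form_one_self_pos {v : Ambient n} (hv : v ≠ 0) : 0 < form 1 v v := by
  have h1 : form 1 v v = ‖v‖ ^ 2 := by
    rw [EuclideanSpace.norm_sq_eq]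
    simp [form, signature, pow_two]
  rw [h1]
  have := norm_pos_iff.mpr hv
  positivity

/-- Tangent vectors of the space form are spacelike. -/
theorem form_self_pos_of_tangent {ε : ℝ} (hε : ε = 1 ∨ ε = -1) {x u : Ambient n}
    (hx : x ∈ space ε n) (hu : form ε x u = 0) (hu0 : u ≠ 0) : 0 < form ε u u := by
  rcases hε with rfl | rfl
  · exact form_one_self_pos hu0
  have hx0 := hx.2 rfl
  have hxx := hx.1
  set l := Fin.last n
  -- This combination of x and u has no timelike coordinate, so its square is nonnegative; expanding
  -- the square compares ⟨u, u⟩ with u_l².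
  have hz : (u l • x - x l • u) l = 0 := by simp; ring
  have key : form (-1) (u l • x - x l • u) (u l • x - x l • u) =
      -(u l) ^ 2 + (x l) ^ 2 * form (-1) u u := by
    simp only [form_sub_left, form_sub_right, form_smul_left, form_smul_right, hu,
      form_comm (-1) u x, hxx]
    ring
  by_cases h0 : u l = 0
  · exact form_self_pos_of_last h0 hu0
  by_cases hz0 : u l • x - x l • u = 0
  · have h2 := congrArg (form (-1) x) hz0
    simp [hu, hxx] at h2
    exact absurd h2 h0
  have := form_self_pos_of_last (ε := -1) hz hz0
  rw [key] at this
  by_contra hneg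
  have h3 : (x l) ^ 2 * form (-1) u u ≤ 0 :=
    mul_nonpos_of_nonneg_of_nonpos (by positivity) (not_lt.mp hneg)
  nlinarith [sq_nonneg (u l)]

/-- Two points of hyperbolic space have negative product. -/
theorem form_neg_of_mem {x y : Ambient n} (hx : x ∈ space (-1) n) (hy : y ∈ space (-1) n) :
    form (-1) x y < 0 := by
  have hx0 := hx.2 rfl
  have hy0 := hy.2 rfl
  set l := Fin.last n
  have hz : (y l • x - x l • y) l = 0 := by simp; ring
  have key : form (-1) (y l • x - x l • y) (y l • x - x l • y) =
      -(y l) ^ 2 - (x l) ^ 2 - 2 * (x l * y l) * form (-1) x y := by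
    simp only [form_sub_left, form_sub_right, form_smul_left, form_smul_right,
      form_comm (-1) y x, hx.1, hy.1]
    ring
  have h0 : 0 ≤ form (-1) (y l • x - x l • y) (y l • x - x l • y) := by
    by_cases hz0 : y l • x - x l • y = 0
    · rw [hz0]; simp
    · exact (form_self_pos_of_last hz hz0).le
  rw [key] at h0
  by_contra hneg
  have h3 : 0 ≤ 2 * (x l * y l) * form (-1) x y :=
    mul_nonneg (by positivity) (not_lt.mp hneg)
  nlinarith [sq_nonneg (x l), pow_pos hy0 2]

/-! ### The cone over the space form -/

/-- The open cone over the space form. -/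
def cone (ε : ℝ) (n : ℕ) : Set (Ambient n) :=
  {y | 0 < ε * form ε y y ∧ (ε = -1 → 0 < y (Fin.last n))}

theorem continuous_form (ε : ℝ) : Continuous fun y : Ambient n => ε * form ε y y := by
  unfold form; fun_prop

theorem isOpen_cone (ε : ℝ) : IsOpen (cone ε n) := by
  have h1 : IsOpen {y : Ambient n | 0 < ε * form ε y y} :=
    isOpen_lt continuous_const (continuous_form ε)
  have h2 : IsOpen {y : Ambient n | ε = -1 → 0 < y (Fin.last n)} := by
    by_cases h : ε = -1
    · simp only [h, forall_const]
      exact isOpen_lt continuous_const (by fun_prop)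
    · simp [h]
  exact h1.inter h2

theorem space_subset_cone {ε : ℝ} (hε : ε = 1 ∨ ε = -1) : space ε n ⊆ cone ε n := fun x hx =>
  ⟨by rw [hx.1, sq_eq_one hε]; norm_num, hx.2⟩

theorem smul_mem_cone {ε : ℝ} {y : Ambient n} (hy : y ∈ cone ε n) {t : ℝ} (ht : 0 < t) :
    t • y ∈ cone ε n := by
  refine ⟨?_, fun h => ?_⟩
  · have : ε * form ε (t • y) (t • y) = t ^ 2 * (ε * form ε y y) := by simp; ring
    rw [this]
    exact mul_pos (by positivity) hy.1
  · simpa using mul_pos ht (hy.2 h)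

/-- The radial coordinate `|y|`. -/
def radius (ε : ℝ) (y : Ambient n) : ℝ := √(ε * form ε y y)

theorem radius_pos {ε : ℝ} {y : Ambient n} (hy : y ∈ cone ε n) : 0 < radius ε y :=
  Real.sqrt_pos.mpr hy.1

theorem radius_smul (ε : ℝ) {t : ℝ} (ht : 0 < t) (y : Ambient n) :
    radius ε (t • y) = t * radius ε y := by
  have : ε * form ε (t • y) (t • y) = t ^ 2 * (ε * form ε y y) := by simp; ring
  rw [radius, this, Real.sqrt_mul (by positivity), Real.sqrt_sq ht.le, radius]

theorem radial_eq (ε : ℝ) (y : Ambient n) : radial ε y = (radius ε y)⁻¹ • y := rfl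

theorem radial_smul (ε : ℝ) {t : ℝ} (ht : 0 < t) (y : Ambient n) :
    radial ε (t • y) = radial ε y := by
  rw [radial_eq, radial_eq, radius_smul ε ht, smul_smul, mul_inv, mul_assoc, mul_comm, mul_assoc,
    mul_inv_cancel₀ ht.ne', mul_one]

theorem radius_of_mem {ε : ℝ} (hε : ε = 1 ∨ ε = -1) {x : Ambient n} (hx : x ∈ space ε n) :
    radius ε x = 1 := by
  rw [radius, hx.1, sq_eq_one hε, Real.sqrt_one]

theorem radial_of_mem {ε : ℝ} (hε : ε = 1 ∨ ε = -1) {x : Ambient n} (hx : x ∈ space ε n) :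
    radial ε x = x := by
  rw [radial_eq, radius_of_mem hε hx, inv_one, one_smul]

theorem radial_mem {ε : ℝ} (hε : ε = 1 ∨ ε = -1) {y : Ambient n} (hy : y ∈ cone ε n) :
    radial ε y ∈ space ε n := by
  have h := radius_pos hy
  refine ⟨?_, fun h' => (smul_mem_cone hy (inv_pos.mpr h)).2 h'⟩
  have h2 : radius ε y ^ 2 = ε * form ε y y := Real.sq_sqrt hy.1.le
  have h3 : form ε y y = ε * radius ε y ^ 2 := by
    rw [h2, ← mul_assoc, sq_eq_one hε, one_mul]
  rw [radial_eq, form_smul_left, form_smul_right, h3]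
  field_simp

theorem radius_smul_radial {ε : ℝ} {y : Ambient n} (hy : y ∈ cone ε n) :
    radius ε y • radial ε y = y := by
  rw [radial_eq, smul_smul, mul_inv_cancel₀ (radius_pos hy).ne', one_smul]

theorem contDiffAt_radius {ε : ℝ} {y : Ambient n} (hy : y ∈ cone ε n) :
    ContDiffAt ℝ ∞ (radius ε) y := by
  have h : ContDiff ℝ ∞ fun y : Ambient n => ε * form ε y y := by unfold form; fun_prop
  exact h.contDiffAt.sqrt hy.1.ne'

theorem contDiffAt_radial {ε : ℝ} {y : Ambient n} (hy : y ∈ cone ε n) :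
    ContDiffAt ℝ ∞ (radial ε) y :=
  ((contDiffAt_radius hy).inv (radius_pos hy).ne').smul contDiffAt_id

/-- The cone is the punctured space for ε = 1, connected in dimension at least 2. For ε = -1 it is
the open future cone, convex because two future timelike vectors have negative product. -/
theorem isPreconnected_cone {ε : ℝ} (hε : ε = 1 ∨ ε = -1) (hn : 1 ≤ n) :
    IsPreconnected (cone ε n) := by
  rcases hε with rfl | rfl
  · have : cone 1 n = ({0}ᶜ : Set (Ambient n)) := by
      ext y
      constructor
      · rintro ⟨h, -⟩ h0
        rw [Set.mem_singleton_iff] at h0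
        rw [h0] at h
        simp at h
      · intro h
        exact ⟨by rw [one_mul]; exact form_one_self_pos h, fun h' => by norm_num at h'⟩
    rw [this]
    apply IsConnected.isPreconnected
    apply isConnected_compl_singleton_of_one_lt_rank
    rw [← Module.finrank_eq_rank, finrank_euclideanSpace_fin]
    exact_mod_cast (by omega : 1 < n + 1)
  · apply Convex.isPreconnected
    apply (convex_iff_forall_pos).mpr
    intro x hx y hy a b ha hb _
    have hx' := smul_mem_cone hx ha
    have hy' := smul_mem_cone hy hb
    have h1 := form_neg_of_mem (radial_mem (Or.inr rfl) hx') (radial_mem (Or.inr rfl) hy')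
    rw [radial_eq, radial_eq, form_smul_left, form_smul_right] at h1
    have hrx := inv_pos.mpr (radius_pos hx')
    have hry := inv_pos.mpr (radius_pos hy')
    have h2 : form (-1) (a • x) (b • y) < 0 := by
      rw [← mul_assoc] at h1
      by_contra hneg
      exact absurd h1 (not_lt.mpr (mul_nonneg (mul_pos hrx hry).le (not_lt.mp hneg)))
    refine ⟨?_, fun h => ?_⟩
    · have h3 := hx'.1
      have h4 := hy'.1
      set X := a • x
      set Y := b • y
      have : form (-1) (X + Y) (X + Y) = form (-1) X X + form (-1) Y Y + 2 * form (-1) X Y := by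
        simp only [form_add_left, form_add_right, form_comm (-1) Y X]; ring
      rw [this]; linarith
    · exact add_pos (hx'.2 h) (hy'.2 h)

theorem isPreconnected_space {ε : ℝ} (hε : ε = 1 ∨ ε = -1) (hn : 1 ≤ n) :
    IsPreconnected (space ε n) := by
  have : space ε n = radial ε '' cone ε n := by
    ext x
    constructor
    · exact fun hx => ⟨x, space_subset_cone hε hx, radial_of_mem hε hx⟩
    · rintro ⟨y, hy, rfl⟩
      exact radial_mem hε hy
  rw [this]
  exact (isPreconnected_cone hε hn).image _ fun y hy =>
    (contDiffAt_radial hy).continuousAt.continuousWithinAt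

/-! ### Homogeneous extensions and rigidity -/

theorem contDiffAt_comp_radial {ε : ℝ} (hε : ε = 1 ∨ ε = -1) {f : Ambient n → E}
    (hf : IsSmooth ε f) {y : Ambient n} (hy : y ∈ cone ε n) :
    ContDiffAt ℝ ∞ (fun z => f (radial ε z)) y := by
  have h1 := (hf _ (radial_mem hε hy)).comp y (contDiffAt_radial hy)
  refine h1.congr_of_eventuallyEq ?_
  filter_upwards [(isOpen_cone ε).mem_nhds hy] with z hz
  simp only [Function.comp]
  rw [radial_of_mem hε (radial_mem hε hz)]

/-- The radial extension is constant along rays. Hence `dirDeriv` only sees the tangential part of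
its direction. -/
theorem dirDeriv_self {ε : ℝ} {f : Ambient n → E} (hf : IsSmooth ε f)
    {x : Ambient n} (hx : x ∈ space ε n) : dirDeriv ε f x x = 0 := by
  have h1 : HasFDerivAt (fun y => f (radial ε y)) (fderiv ℝ (fun y => f (radial ε y)) x)
      ((1 : ℝ) • x) := by
    rw [one_smul]
    exact ((hf x hx).differentiableAt (by simp)).hasFDerivAt
  have h2 : HasDerivAt (fun t : ℝ => t • x) x 1 := by
    simpa using (hasDerivAt_id (1 : ℝ)).smul_const x
  have h3 := h1.comp_hasDerivAt (1 : ℝ) h2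
  have h4 : HasDerivAt (fun _ : ℝ => f (radial ε x)) (dirDeriv ε f x x) 1 := by
    refine h3.congr_of_eventuallyEq ?_
    filter_upwards [lt_mem_nhds (show (0 : ℝ) < 1 by norm_num)] with t ht
    simp only [Function.comp]
    rw [radial_smul ε ht]
  exact h4.unique (hasDerivAt_const _ _)

theorem dirDeriv_proj {ε : ℝ} {f : Ambient n → E} (hf : IsSmooth ε f)
    {x : Ambient n} (hx : x ∈ space ε n) (X : Ambient n) :
    dirDeriv ε f x (proj ε x X) = dirDeriv ε f x X := by
  have := dirDeriv_self hf hx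
  unfold dirDeriv at this ⊢
  rw [proj, map_sub, map_smul, this, smul_zero, sub_zero]

theorem proj_mem {ε : ℝ} (hε : ε = 1 ∨ ε = -1) {x : Ambient n} (hx : x ∈ space ε n)
    (X : Ambient n) : form ε x (proj ε x X) = 0 := by
  rw [proj, form_sub_right, form_smul_right, hx.1, form_comm ε X x]
  linear_combination (-form ε x X) * sq_eq_one hε

/-- The extension of a map on the space form to the cone that is homogeneous of degree one. -/
def homExt (ε : ℝ) (f : Ambient n → E) (y : Ambient n) : E := radius ε y • f (radial ε y)

theorem homExt_smul (ε : ℝ) (f : Ambient n → E) {t : ℝ} (ht : 0 < t) (y : Ambient n) :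
    homExt ε f (t • y) = t • homExt ε f y := by
  rw [homExt, homExt, radius_smul ε ht, radial_smul ε ht, smul_smul]

theorem contDiffAt_homExt {ε : ℝ} (hε : ε = 1 ∨ ε = -1) {f : Ambient n → E}
    (hf : IsSmooth ε f) {y : Ambient n} (hy : y ∈ cone ε n) : ContDiffAt ℝ ∞ (homExt ε f) y :=
  (contDiffAt_radius hy).smul (contDiffAt_comp_radial hε hf hy)

theorem hasFDerivAt_radius {ε : ℝ} (hε : ε = 1 ∨ ε = -1) {x : Ambient n} (hx : x ∈ space ε n) :
    HasFDerivAt (radius ε) (ε • formL ε n x) x := by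
  have h1 := ((hasFDerivAt_form ε (hasFDerivAt_id x) (hasFDerivAt_id x)).const_mul ε)
  have h2 := h1.sqrt (by simp only [id, hx.1, sq_eq_one hε]; norm_num)
  refine h2.congr_fderiv ?_
  ext X
  simp only [id, hx.1, sq_eq_one hε, Real.sqrt_one, smul_apply, add_apply, smul_eq_mul,
    ContinuousLinearMap.comp_apply, ContinuousLinearMap.flip_apply, formL_apply,
    ContinuousLinearMap.id_apply, form_comm ε X x]
  ring

theorem fderiv_homExt_of_mem {ε : ℝ} (hε : ε = 1 ∨ ε = -1) {f : Ambient n → E}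
    (hf : IsSmooth ε f) {x : Ambient n} (hx : x ∈ space ε n) (X : Ambient n) :
    fderiv ℝ (homExt ε f) x X = (ε * form ε x X) • f x + dirDeriv ε f x X := by
  have h1 := (hasFDerivAt_radius hε hx).smul ((hf x hx).differentiableAt (by simp)).hasFDerivAt
  have h2 : fderiv ℝ (homExt ε f) x = _ := h1.fderiv
  rw [h2]
  simp only [add_apply, smul_apply, ContinuousLinearMap.smulRight_apply, formL_apply,
    radius_of_mem hε hx, radial_of_mem hε hx, one_smul, smul_eq_mul]
  rw [add_comm]
  rfl

/-- The differential of a map homogeneous of degree one is homogeneous of degree zero, so pointwise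
identities for it on the space form spread to the whole open cone. -/
theorem fderiv_homExt {ε : ℝ} (hε : ε = 1 ∨ ε = -1) {f : Ambient n → E}
    (hf : IsSmooth ε f) {y : Ambient n} (hy : y ∈ cone ε n) :
    fderiv ℝ (homExt ε f) y = fderiv ℝ (homExt ε f) (radial ε y) := by
  have hr := radius_pos hy
  have h1 : HasFDerivAt (homExt ε f) (fderiv ℝ (homExt ε f) (radial ε y))
      ((radius ε y)⁻¹ • y) := by
    rw [← radial_eq]
    exact ((contDiffAt_homExt hε hf (space_subset_cone hε (radial_mem hε hy))).differentiableAt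
      (by simp)).hasFDerivAt
  have h2 : HasFDerivAt (fun z : Ambient n => (radius ε y)⁻¹ • z)
      ((radius ε y)⁻¹ • ContinuousLinearMap.id ℝ (Ambient n)) y :=
    ((radius ε y)⁻¹ • ContinuousLinearMap.id ℝ (Ambient n)).hasFDerivAt
  have h3 := (h1.comp y h2).const_smul (radius ε y)
  have h4 : HasFDerivAt (homExt ε f) (fderiv ℝ (homExt ε f) (radial ε y)) y := by
    refine (h3.congr_fderiv ?_).congr_of_eventuallyEq ?_
    · ext X
      simp [smul_smul, hr.ne']
    · refine Filter.Eventually.of_forall fun z => ?_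
      simp only [Function.comp, Pi.smul_apply]
      rw [homExt_smul ε f (inv_pos.mpr hr), smul_smul, mul_inv_cancel₀ hr.ne', one_smul]
  exact h4.fderiv

theorem fderiv_apply_eq_zero_of_const {U : Set (Ambient n)} (hU : IsOpen U) {x : Ambient n}
    (hx : x ∈ U) {f : Ambient n → ℝ} {f' : Ambient n →L[ℝ] ℝ} (h : HasFDerivAt f f' x) {c : ℝ}
    (hc : ∀ y ∈ U, f y = c) (X : Ambient n) : f' X = 0 := by
  have h1 : HasFDerivAt f (0 : Ambient n →L[ℝ] ℝ) x := by
    refine (hasFDerivAt_const c x).congr_of_eventuallyEq ?_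
    filter_upwards [hU.mem_nhds hx] with y hy using hc y hy
  rw [h.unique h1]
  rfl

/-- A trilinear quantity symmetric in the first two and skew in the last two slots vanishes. -/
theorem eq_zero_of_symm_of_skew {α : Type*} (T : α → α → α → ℝ) (h1 : ∀ a b c, T a b c = T b a c)
    (h2 : ∀ a b c, T a b c + T a c b = 0) (a b c : α) : T a b c = 0 := by
  -- In e1 - e2 + e3 the symmetries cancel everything except 2 T a b c.
  have e1 := h2 a b c
  have e2 := h2 c a b
  have e3 := h2 b c a
  have s1 := h1 a b c
  have s2 := h1 a c b
  have s3 := h1 b c a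
  linarith

theorem exists_fderiv_eq_of_snd_zero {U : Set (Ambient n)} (hU : IsOpen U) (hc : IsPreconnected U)
    {g : Ambient n → Ambient n} (hg : ∀ y ∈ U, ContDiffAt ℝ ∞ g y)
    (h : ∀ y ∈ U, ∀ Z X, fderiv ℝ (fderiv ℝ g) y Z X = 0) :
    ∃ A : Ambient n →L[ℝ] Ambient n, ∀ y ∈ U, fderiv ℝ g y = A := by
  refine hU.exists_is_const_of_fderiv_eq_zero (𝕜 := ℝ) hc (fun y hy => ?_) fun y hy => ?_
  · exact (((hg y hy).fderiv_right (m := 1) (by norm_cast)).differentiableAt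
      (by simp)).differentiableWithinAt
  · ext Z X : 2
    rw [h y hy]; rfl

theorem hasFDerivAt_fderiv_apply {g : Ambient n → Ambient n} {y : Ambient n}
    (hg : ContDiffAt ℝ ∞ g y) (X : Ambient n) :
    HasFDerivAt (fun z => fderiv ℝ g z X) ((fderiv ℝ (fderiv ℝ g) y).flip X) y := by
  have h : DifferentiableAt ℝ (fderiv ℝ g) y :=
    ((hg.fderiv_right (m := 1) (by norm_cast)).differentiableAt (by simp))
  have := h.hasFDerivAt.clm_apply (hasFDerivAt_const X y)
  refine this.congr_fderiv ?_
  ext Z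
  simp

theorem snd_symm {g : Ambient n → Ambient n} {y : Ambient n}
    (hg : ContDiffAt ℝ ∞ g y) (X Z : Ambient n) :
    fderiv ℝ (fderiv ℝ g) y X Z = fderiv ℝ (fderiv ℝ g) y Z X :=
  (hg.isSymmSndFDerivAt (by simp; norm_cast)) X Z

/-- An infinitesimal isometry of a flat space has constant differential. -/
theorem exists_fderiv_eq_of_skew {ε : ℝ} (hε : ε = 1 ∨ ε = -1) {U : Set (Ambient n)}
    (hU : IsOpen U) (hc : IsPreconnected U)
    {g : Ambient n → Ambient n} (hg : ∀ y ∈ U, ContDiffAt ℝ ∞ g y)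
    (h : ∀ y ∈ U, ∀ X Y, form ε (fderiv ℝ g y X) Y + form ε X (fderiv ℝ g y Y) = 0) :
    ∃ A : Ambient n →L[ℝ] Ambient n, ∀ y ∈ U, fderiv ℝ g y = A := by
  refine exists_fderiv_eq_of_snd_zero hU hc hg fun y hy Z X => ?_
  refine eq_zero_of_form hε fun Y => ?_
  -- The quantity ⟨D²g(Z, X), Y⟩ is symmetric in Z, X as a second derivative, and skew in X, Y by
  -- differentiating the hypothesis along Z.
  refine eq_zero_of_symm_of_skew (fun Z X Y => form ε (fderiv ℝ (fderiv ℝ g) y Z X) Y)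
    (fun Z X Y => by rw [snd_symm (hg y hy)]) (fun Z X Y => ?_) Z X Y
  have h1 := (hasFDerivAt_form ε (hasFDerivAt_fderiv_apply (hg y hy) X) (hasFDerivAt_const Y y)).add
    (hasFDerivAt_form ε (hasFDerivAt_const X y) (hasFDerivAt_fderiv_apply (hg y hy) Y))
  have h3 := fderiv_apply_eq_zero_of_const hU hy h1 (c := 0) (fun z hz => h z hz X Y) Z
  simp only [add_apply, ContinuousLinearMap.comp_apply, ContinuousLinearMap.flip_apply,
    formL_apply, zero_apply, form_zero_left, form_zero_right,
    zero_add, add_zero] at h3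
  rw [form_comm ε X] at h3
  exact h3

/-- A local isometry of a flat space has constant differential. -/
theorem exists_fderiv_eq_of_isometry {ε : ℝ} (hε : ε = 1 ∨ ε = -1) {U : Set (Ambient n)}
    (hU : IsOpen U) (hc : IsPreconnected U)
    {g : Ambient n → Ambient n} (hg : ∀ y ∈ U, ContDiffAt ℝ ∞ g y)
    (h : ∀ y ∈ U, ∀ X Y, form ε (fderiv ℝ g y X) (fderiv ℝ g y Y) = form ε X Y) :
    ∃ A : Ambient n →L[ℝ] Ambient n, ∀ y ∈ U, fderiv ℝ g y = A := by
  refine exists_fderiv_eq_of_snd_zero hU hc hg fun y hy Z X => ?_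
  -- Since Dg preserves a nondegenerate form it is bijective, so it suffices to test D²g(Z, X)
  -- against the vectors Dg(Y).
  have hinj : Function.Injective (fderiv ℝ g y : Ambient n →ₗ[ℝ] Ambient n) := by
    rw [← LinearMap.ker_eq_bot, LinearMap.ker_eq_bot']
    intro v hv
    refine eq_zero_of_form hε fun w => ?_
    rw [← h y hy v w]
    have : fderiv ℝ g y v = 0 := hv
    rw [this, form_zero_left]
  have hsurj := LinearMap.injective_iff_surjective.mp hinj
  refine eq_zero_of_form hε fun Y' => ?_
  obtain ⟨Y, rfl⟩ := hsurj Y'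
  refine eq_zero_of_symm_of_skew
    (fun Z X Y => form ε (fderiv ℝ (fderiv ℝ g) y Z X) (fderiv ℝ g y Y))
    (fun Z X Y => by rw [snd_symm (hg y hy)]) (fun Z X Y => ?_) Z X Y
  have h1 := hasFDerivAt_form ε (hasFDerivAt_fderiv_apply (hg y hy) X)
    (hasFDerivAt_fderiv_apply (hg y hy) Y)
  have h3 := fderiv_apply_eq_zero_of_const hU hy h1 (fun z hz => h z hz X Y) Z
  simp only [add_apply, ContinuousLinearMap.comp_apply, ContinuousLinearMap.flip_apply,
    formL_apply] at h3
  rw [form_comm ε (fderiv ℝ g y X)] at h3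
  linarith

/-- Euler's identity for degree one: once the differential is a constant map A, the function itself
is x ↦ Ax. -/
theorem eq_of_fderiv_homExt {ε : ℝ} (hε : ε = 1 ∨ ε = -1) {f : Ambient n → E}
    (hf : IsSmooth ε f) {x : Ambient n} (hx : x ∈ space ε n) :
    f x = fderiv ℝ (homExt ε f) x x := by
  rw [fderiv_homExt_of_mem hε hf hx, hx.1, sq_eq_one hε, one_smul, dirDeriv_self hf hx,
    add_zero]

/-- Derivative of a constant pairing along the space form. -/
theorem form_dirDeriv_add {ε : ℝ} (hε : ε = 1 ∨ ε = -1) {f g : Ambient n → Ambient n}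
    (hf : IsSmooth ε f) (hg : IsSmooth ε g) {c : ℝ} (h : ∀ x ∈ space ε n, form ε (f x) (g x) = c)
    {x : Ambient n} (hx : x ∈ space ε n) (X : Ambient n) :
    form ε (f x) (dirDeriv ε g x X) + form ε (dirDeriv ε f x X) (g x) = 0 := by
  have h1 := hasFDerivAt_form ε ((hf x hx).differentiableAt (by simp)).hasFDerivAt
    ((hg x hx).differentiableAt (by simp)).hasFDerivAt
  have h3 := fderiv_apply_eq_zero_of_const (isOpen_cone ε) (space_subset_cone hε hx) h1
    (fun z hz => h _ (radial_mem hε hz)) X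
  simp only [add_apply, ContinuousLinearMap.comp_apply, ContinuousLinearMap.flip_apply,
    formL_apply, radial_of_mem hε hx] at h3
  exact h3

theorem isSmooth_id {ε : ℝ} (hε : ε = 1 ∨ ε = -1) :
    IsSmooth ε (fun x : Ambient n => x) := fun _ hx => contDiffAt_radial (space_subset_cone hε hx)

theorem dirDeriv_id {ε : ℝ} (hε : ε = 1 ∨ ε = -1) {x : Ambient n} (hx : x ∈ space ε n)
    {X : Ambient n} (hX : form ε x X = 0) : dirDeriv ε (fun x : Ambient n => x) x X = X := by
  rw [dirDeriv_eq_fderiv hε hx differentiableAt_fun_id (fun _ _ => rfl) hX]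
  simp

/-- Killing fields of the space form are restrictions of skew endomorphisms. -/
theorem IsKilling.exists_linear {ε : ℝ} (hε : ε = 1 ∨ ε = -1) (hn : 1 ≤ n)
    {σ : Ambient n → Ambient n} (h : IsKilling ε σ) :
    ∃ A : Ambient n →L[ℝ] Ambient n, (∀ x ∈ space ε n, σ x = A x) ∧
      ((space ε n).Nonempty → ∀ X Y, form ε (A X) Y + form ε X (A Y) = 0) := by
  have hsm := h.smooth
  have key : ∀ x ∈ space ε n, ∀ X Y, form ε (fderiv ℝ (homExt ε σ) x X) Y +
      form ε X (fderiv ℝ (homExt ε σ) x Y) = 0 := by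
    intro x hx
    -- Splitting X and Y into normal and tangential parts: the first two terms are skew in X, Y by
    -- their shape, and the last one is skew by the Killing equation.
    have aux : ∀ X Y, form ε (fderiv ℝ (homExt ε σ) x X) Y =
        ε * form ε x X * form ε (σ x) Y - ε * form ε (σ x) X * form ε x Y
          + form ε (cov ε σ x (proj ε x X)) (proj ε x Y) := by
      intro X Y
      rw [fderiv_homExt_of_mem hε hsm hx, ← dirDeriv_proj hsm hx X]
      have h1 := form_dirDeriv_add hε (isSmooth_id hε) hsm (c := 0)
        (fun x hx => h.tangent x hx) hx (proj ε x X)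
      rw [dirDeriv_id hε hx (proj_mem hε hx X)] at h1
      have h2 : form ε x (σ x) = 0 := h.tangent x hx
      have h3 : form ε (proj ε x X) (σ x) = form ε (σ x) X := by
        rw [proj, form_sub_left, form_smul_left, h2, form_comm]; ring
      rw [h3] at h1
      have h4 := proj_mem hε hx Y
      set D := dirDeriv ε σ x (proj ε x X) with hD
      have h5 : form ε (cov ε σ x (proj ε x X)) (proj ε x Y) = form ε D (proj ε x Y) := by
        rw [cov, ← hD]
        conv_lhs => rw [proj, form_sub_left, form_smul_left, h4]
        ring
      rw [h5]
      conv_rhs => rw [proj, form_sub_right, form_smul_right, form_comm ε D x]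
      rw [form_add_left, form_smul_left, form_comm ε Y x]
      linear_combination (ε * form ε x Y) * h1
    intro X Y
    have hk := h.killing x hx _ (proj_mem hε hx X) _ (proj_mem hε hx Y)
    rw [form_comm ε X, aux X Y, aux Y X]
    rw [form_comm ε (proj ε x X)] at hk
    linear_combination hk
  obtain ⟨A, hA⟩ := exists_fderiv_eq_of_skew hε (isOpen_cone ε) (isPreconnected_cone hε hn)
    (fun y hy => contDiffAt_homExt hε hsm hy) (fun y hy X Y => by
      rw [fderiv_homExt hε hsm hy]
      exact key _ (radial_mem hε hy) X Y)
  refine ⟨A, fun x hx => ?_, ?_⟩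
  · rw [eq_of_fderiv_homExt hε hsm hx, hA x (space_subset_cone hε hx)]
  · rintro ⟨x, hx⟩ X Y
    rw [← hA x (space_subset_cone hε hx)]
    exact key x hx X Y

/-- Isometries of the space form are restrictions of linear isometries. -/
theorem IsIsometry.exists_linear {ε : ℝ} (hε : ε = 1 ∨ ε = -1) (hn : 1 ≤ n)
    {φ : Ambient n → Ambient n} (h : IsIsometry ε φ) :
    ∃ A : Ambient n →L[ℝ] Ambient n, (∀ x ∈ space ε n, φ x = A x) ∧
      ((space ε n).Nonempty → ∀ X Y, form ε (A X) (A Y) = form ε X Y) := by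
  have hsm := h.smooth
  have key : ∀ x ∈ space ε n, ∀ X Y, form ε (fderiv ℝ (homExt ε φ) x X)
      (fderiv ℝ (homExt ε φ) x Y) = form ε X Y := by
    intro x hx X Y
    rw [fderiv_homExt_of_mem hε hsm hx, fderiv_homExt_of_mem hε hsm hx,
      ← dirDeriv_proj hsm hx X, ← dirDeriv_proj hsm hx Y]
    have hφ : ∀ x ∈ space ε n, form ε (φ x) (φ x) = ε := fun x hx => (h.bijOn.mapsTo hx).1
    -- Differentiating ⟨φ, φ⟩ = ε makes the radial and tangential parts of the differential
    -- orthogonal, as they are in the source.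
    have h0 : ∀ Z, form ε (φ x) (dirDeriv ε φ x Z) = 0 := by
      intro Z
      have := form_dirDeriv_add hε hsm hsm hφ hx Z
      rw [form_comm ε (dirDeriv ε φ x Z)] at this
      linarith
    have h1 := h.metric x hx _ (proj_mem hε hx X) _ (proj_mem hε hx Y)
    simp only [form_add_left, form_add_right, form_smul_left, form_smul_right, h0, hφ x hx, h1,
      form_comm ε (dirDeriv ε φ x _) (φ x)]
    simp only [proj, form_sub_left, form_sub_right, form_smul_left, form_smul_right, hx.1,
      form_comm ε _ x]
    linear_combination (2 * form ε x X * form ε x Y * ε - form ε x X * form ε x Y * ε) *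
      sq_eq_one hε + (form ε x X * form ε x Y * ε) * sq_eq_one hε
  obtain ⟨A, hA⟩ := exists_fderiv_eq_of_isometry hε (isOpen_cone ε) (isPreconnected_cone hε hn)
    (fun y hy => contDiffAt_homExt hε hsm hy) (fun y hy X Y => by
      rw [fderiv_homExt hε hsm hy]
      exact key _ (radial_mem hε hy) X Y)
  refine ⟨A, fun x hx => ?_, ?_⟩
  · rw [eq_of_fderiv_homExt hε hsm hx, hA x (space_subset_cone hε hx)]
  · rintro ⟨x, hx⟩ X Y
    rw [← hA x (space_subset_cone hε hx)]
    exact key x hx X Y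

/-! ### Traces over tangent spaces -/

theorem sum_smul_single (x : Ambient n) : ∑ i, x i • EuclideanSpace.single i (1 : ℝ) = x := by
  ext c; simp [Finset.sum_apply, Pi.single_apply]

theorem form_single_left (ε : ℝ) (x : Ambient n) (i : Fin (n + 1)) :
    form ε (EuclideanSpace.single i 1) x = signature ε i * x i := by
  rw [form_comm, form_single]

theorem proj_single {ε : ℝ} (x : Ambient n) (i : Fin (n + 1)) :
    proj ε x (EuclideanSpace.single i 1) =
      EuclideanSpace.single i 1 - (ε * (signature ε i * x i)) • x := by
  rw [proj, form_single_left]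

/-- The ambient trace splits along the tangent space and the normal line, and the unit normal x, of
square ε, contributes ε B(x, x). -/
theorem tangentTrace_bilinear {ε : ℝ} (hε : ε = 1 ∨ ε = -1) {x : Ambient n} (hx : x ∈ space ε n)
    (B : Ambient n →ₗ[ℝ] Ambient n →ₗ[ℝ] E) :
    tangentTrace ε x (fun X Y => B X Y) =
      ∑ i, signature ε i • B (EuclideanSpace.single i 1) (EuclideanSpace.single i 1)
        - ε • B x x := by
  have h1 : ∀ i, signature ε i • B (proj ε x (EuclideanSpace.single i 1))
      (proj ε x (EuclideanSpace.single i 1)) =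
      signature ε i • B (EuclideanSpace.single i 1) (EuclideanSpace.single i 1)
      - ε • (B (x i • EuclideanSpace.single i 1) x) - ε • (B x (x i • EuclideanSpace.single i 1))
      + (signature ε i * (x i * x i)) • B x x := by
    intro i
    have hs := signature_mul_self hε i
    have he := sq_eq_one hε
    simp only [proj_single, map_sub, map_smul, LinearMap.sub_apply, LinearMap.smul_apply,
      smul_sub, smul_smul]
    have e1 : signature ε i * (ε * (signature ε i * x i)) = ε * x i := by
      linear_combination (ε * x i) * hs
    have e2 : signature ε i * (ε * (signature ε i * x i) * (ε * (signature ε i * x i))) =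
        signature ε i * (x i * x i) := by
      linear_combination (signature ε i * ε * ε * x i * x i) * hs +
        (signature ε i * x i * x i) * he
    rw [e1, e2]
    abel
  unfold tangentTrace
  rw [Finset.sum_congr rfl fun i _ => h1 i]
  simp only [Finset.sum_add_distrib, Finset.sum_sub_distrib, ← Finset.smul_sum, ← Finset.sum_smul,
    ← map_sum, ← LinearMap.sum_apply, sum_smul_single]
  have h2 : ∑ i, signature ε i * (x i * x i) = ε := hx.1
  rw [h2]
  abel

theorem tangentTrace_congr {ε : ℝ} (hε : ε = 1 ∨ ε = -1) {x : Ambient n} (hx : x ∈ space ε n)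
    {B B' : Ambient n → Ambient n → E}
    (h : ∀ X Y, form ε x X = 0 → form ε x Y = 0 → B X Y = B' X Y) :
    tangentTrace ε x B = tangentTrace ε x B' := by
  unfold tangentTrace
  refine Finset.sum_congr rfl fun i _ => ?_
  rw [h _ _ (proj_mem hε hx _) (proj_mem hε hx _)]

theorem tangentTrace_add (ε : ℝ) (x : Ambient n) (B B' : Ambient n → Ambient n → E) :
    tangentTrace ε x (fun X Y => B X Y + B' X Y) = tangentTrace ε x B + tangentTrace ε x B' := by
  simp only [tangentTrace, smul_add, Finset.sum_add_distrib]

theorem tangentTrace_const_smul (ε c : ℝ) (x : Ambient n) (B : Ambient n → Ambient n → E) :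
    tangentTrace ε x (fun X Y => c • B X Y) = c • tangentTrace ε x B := by
  simp only [tangentTrace, Finset.smul_sum]
  exact Finset.sum_congr rfl fun i _ => smul_comm _ _ _

theorem trace_eq_sum (C : Ambient n →ₗ[ℝ] Ambient n) :
    LinearMap.trace ℝ (Ambient n) C = ∑ i, C (EuclideanSpace.single i 1) i := by
  rw [LinearMap.trace_eq_matrix_trace ℝ (EuclideanSpace.basisFun (Fin (n + 1)) ℝ).toBasis]
  simp [Matrix.trace, LinearMap.toMatrix_apply]

theorem tangentTrace_form {ε : ℝ} (hε : ε = 1 ∨ ε = -1) {x : Ambient n} (hx : x ∈ space ε n)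
    (C : Ambient n →ₗ[ℝ] Ambient n) :
    tangentTrace ε x (fun X Y => form ε (C X) Y) =
      LinearMap.trace ℝ (Ambient n) C - ε * form ε (C x) x := by
  have := tangentTrace_bilinear hε hx (LinearMap.mk₂ ℝ (fun X Y => form ε (C X) Y)
    (by intros; simp) (by intros; simp) (by intros; simp) (by intros; simp))
  simp only [LinearMap.mk₂_apply] at this
  rw [this, trace_eq_sum]
  simp only [form_single, smul_eq_mul, ← mul_assoc, signature_mul_self hε, one_mul]

theorem tangentTrace_smul {ε : ℝ} (hε : ε = 1 ∨ ε = -1) {x : Ambient n} (hx : x ∈ space ε n)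
    (v : Ambient n) : tangentTrace ε x (fun X Y => form ε v X • Y) = proj ε x v := by
  have := tangentTrace_bilinear hε hx (LinearMap.mk₂ ℝ (fun X Y => form ε v X • Y)
    (by intros; simp [add_smul]) (by intros; simp [mul_smul]) (by intros; simp)
    (fun c X Y => smul_comm _ _ _))
  simp only [LinearMap.mk₂_apply] at this
  rw [this]
  simp only [form_single, smul_smul, ← mul_assoc, signature_mul_self hε, one_mul, sum_smul_single]
  rw [proj]

theorem tangentTrace_form_smul {ε : ℝ} (hε : ε = 1 ∨ ε = -1) {x : Ambient n}
    (hx : x ∈ space ε n) (v : E) :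
    tangentTrace ε x (fun X Y => form ε X Y • v) = (n : ℝ) • v := by
  have h := tangentTrace_form hε hx LinearMap.id
  simp only [LinearMap.id_apply, LinearMap.trace_id, finrank_euclideanSpace_fin, hx.1,
    sq_eq_one hε] at h
  simp only [tangentTrace, smul_smul, ← Finset.sum_smul, smul_eq_mul] at h ⊢
  rw [h]
  push_cast
  rw [add_sub_cancel_right]

/-! ### The geometry of linear Killing fields -/

section Linear

variable {ε : ℝ} {A : Ambient n →L[ℝ] Ambient n} {σ : Ambient n → Ambient n} {x : Ambient n}

theorem form_apply_self (hA : ∀ X Y, form ε (A X) Y + form ε X (A Y) = 0) (X : Ambient n) :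
    form ε (A X) X = 0 := by
  have := hA X X
  rw [form_comm ε X] at this
  linarith

theorem form_apply_swap (hA : ∀ X Y, form ε (A X) Y + form ε X (A Y) = 0) (X Y : Ambient n) :
    form ε X (A Y) = -form ε (A X) Y := by
  linarith [hA X Y]

theorem proj_apply_self (hA : ∀ X Y, form ε (A X) Y + form ε X (A Y) = 0) :
    proj ε x (A x) = A x := by
  rw [proj, form_apply_self hA]; simp

theorem cov_linear (hε : ε = 1 ∨ ε = -1) (hσ : ∀ x ∈ space ε n, σ x = A x)
    (hx : x ∈ space ε n) {X : Ambient n} (hX : form ε x X = 0) :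
    cov ε σ x X = proj ε x (A X) := by
  rw [cov, dirDeriv_eq_fderiv hε hx A.differentiableAt hσ hX, A.fderiv]

theorem proj_smul_self (hε : ε = 1 ∨ ε = -1) (hx : x ∈ space ε n) (c : ℝ) :
    proj ε x (c • x) = 0 := by
  rw [proj, form_smul_left, hx.1, mul_left_comm, sq_eq_one hε, mul_one, sub_self]

theorem proj_add (X Y : Ambient n) : proj ε x (X + Y) = proj ε x X + proj ε x Y := by
  simp only [proj, form_add_left, mul_add, add_smul]; abel

theorem proj_smul (c : ℝ) (X : Ambient n) : proj ε x (c • X) = c • proj ε x X := by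
  simp only [proj, form_smul_left, smul_sub, smul_smul]; ring_nf

theorem proj_of_tangent {X : Ambient n} (hX : form ε x X = 0) : proj ε x X = X := by
  rw [proj, form_comm, hX]; simp

/-- The extension y ↦ `proj ε y Y` is parallel at x, which removes the correction term from `cov₂`.
-/
theorem cov_proj (hε : ε = 1 ∨ ε = -1) (hx : x ∈ space ε n) {X Y : Ambient n}
    (hX : form ε x X = 0) (hY : form ε x Y = 0) :
    cov ε (fun y => proj ε y Y) x X = 0 := by
  have h1 : HasFDerivAt (fun y : Ambient n => proj ε y Y) _ x :=
    (hasFDerivAt_const Y x).sub (((hasFDerivAt_form ε (hasFDerivAt_const Y x)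
      (hasFDerivAt_id x)).const_mul ε).smul (hasFDerivAt_id x))
  rw [cov, dirDeriv_eq_fderiv hε hx h1.differentiableAt (fun _ _ => rfl) hX, h1.fderiv]
  have : ∀ c : ℝ, proj ε x (-(c • x)) = 0 := fun c => by
    rw [← neg_smul, proj_smul_self hε hx]
  simp [formL_apply, form_comm ε Y x, hY, this]

/-- This is Kostant's identity ∇²_{X,Y}σ = -R(σ, X)Y, with the curvature tensor R(U, V)W = ε(⟨V, W⟩U
- ⟨U, W⟩V). -/
theorem cov₂_linear (hε : ε = 1 ∨ ε = -1) (hA : ∀ X Y, form ε (A X) Y + form ε X (A Y) = 0)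
    (hσ : ∀ x ∈ space ε n, σ x = A x) (hx : x ∈ space ε n) {X Y : Ambient n}
    (hX : form ε x X = 0) (hY : form ε x Y = 0) :
    cov₂ ε σ x X Y = (-ε) • (form ε X Y • A x) + ε • (form ε (A x) Y • X) := by
  rw [cov₂, cov_proj hε hx hX hY, cov_linear hε hσ hx (form_zero_right ε x), map_zero]
  have h0 : proj ε x (0 : Ambient n) = 0 := by simp [proj]
  -- The field y ↦ ∇_{proj Y}σ agrees on the space form with this polynomial map, which can be
  -- differentiated in the ambient space.
  have h1 : HasFDerivAt (fun y : Ambient n => A Y - (ε * form ε Y y) • A y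
      - (ε * form ε (A Y) y) • y) _ x :=
    ((hasFDerivAt_const (A Y) x).sub (((hasFDerivAt_form ε (hasFDerivAt_const Y x)
      (hasFDerivAt_id x)).const_mul ε).smul A.hasFDerivAt)).sub
      (((hasFDerivAt_form ε (hasFDerivAt_const (A Y) x)
      (hasFDerivAt_id x)).const_mul ε).smul (hasFDerivAt_id x))
  have h2 : ∀ y ∈ space ε n, cov ε σ y (proj ε y Y) = A Y - (ε * form ε Y y) • A y
      - (ε * form ε (A Y) y) • y := by
    intro y hy
    rw [cov_linear hε hσ hy (proj_mem hε hy Y)]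
    simp only [proj, map_sub, map_smul, form_sub_left, form_smul_left, form_apply_self hA,
      mul_zero, sub_zero]
  have h3 : form ε (A Y) x = -form ε (A x) Y := by
    rw [form_comm, form_apply_swap hA]
  have h4 : ∀ c d e : ℝ, proj ε x (-(c • A x) - (d • X + e • x)) = -(c • A x) - d • X := by
    intro c d e
    have : -(c • A x) - (d • X + e • x) = (-c) • A x + ((-d) • X + (-e) • x) := by module
    rw [this, proj_add, proj_add, proj_smul, proj_smul, proj_smul_self hε hx,
      proj_apply_self hA, proj_of_tangent hX]
    module
  have h5 : fderiv ℝ (fun y : Ambient n => A Y - (ε * form ε Y y) • A y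
      - (ε * form ε (A Y) y) • y) x X =
      -((ε * form ε X Y) • A x) - ((-(ε * form ε (A x) Y)) • X + (ε * form ε (A Y) X) • x) := by
    rw [h1.fderiv]
    simp only [sub_apply, add_apply, smul_apply, ContinuousLinearMap.smulRight_apply,
      ContinuousLinearMap.comp_apply, ContinuousLinearMap.flip_apply, zero_apply,
      ContinuousLinearMap.id_apply, formL_apply, id, h3, form_comm ε Y x, hY, form_comm ε Y X,
      form_zero_left, smul_eq_mul]
    module
  rw [h0, sub_zero, cov, dirDeriv_eq_fderiv hε hx h1.differentiableAt h2 hX, h5, h4]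
  module

theorem roughLaplacian_linear (hε : ε = 1 ∨ ε = -1)
    (hA : ∀ X Y, form ε (A X) Y + form ε X (A Y) = 0)
    (hσ : ∀ x ∈ space ε n, σ x = A x) (hx : x ∈ space ε n) :
    roughLaplacian ε σ x = (ε * (n - 1)) • A x := by
  have h1 : tangentTrace ε x (fun X Y => cov₂ ε σ x X Y) =
      tangentTrace ε x fun X Y => (-ε) • (form ε X Y • A x) + ε • (form ε (A x) X • Y) := by
    unfold tangentTrace
    refine Finset.sum_congr rfl fun i _ => ?_
    beta_reduce
    rw [cov₂_linear hε hA hσ hx (proj_mem hε hx _) (proj_mem hε hx _)]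
  rw [roughLaplacian, h1, tangentTrace_add ε x (fun X Y => (-ε) • (form ε X Y • A x))
    (fun X Y => ε • (form ε (A x) X • Y)), tangentTrace_const_smul, tangentTrace_const_smul,
    tangentTrace_form_smul hε hx, tangentTrace_smul hε hx, proj_apply_self hA]
  module

theorem lengthSq_linear (hσ : ∀ x ∈ space ε n, σ x = A x) (hx : x ∈ space ε n) :
    lengthSq ε σ x = form ε (A x) (A x) := by
  rw [lengthSq, hσ x hx]

theorem hasFDerivAt_form_apply (A : Ambient n →L[ℝ] Ambient n) (x : Ambient n) :
    HasFDerivAt (fun y => form ε (A y) (A y))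
      ((formL ε n (A x)).comp A + ((formL ε n).flip (A x)).comp A) x :=
  hasFDerivAt_form ε A.hasFDerivAt A.hasFDerivAt

/-- The differential of ½|Ax|² pairs with X to ⟨Ax, AX⟩ = ⟨-A²x, X⟩; the gradient is the tangential
part of -A²x. -/
theorem grad_linear (hε : ε = 1 ∨ ε = -1)
    (hA : ∀ X Y, form ε (A X) Y + form ε X (A Y) = 0)
    (hσ : ∀ x ∈ space ε n, σ x = A x) (hx : x ∈ space ε n) :
    grad ε (halfLengthSq ε σ) x = -(A (A x)) - (ε * form ε (A x) (A x)) • x := by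
  have h1 : ∀ X, form ε x X = 0 →
      dirDeriv ε (halfLengthSq ε σ) x X = form ε (-(A (A x))) X := by
    intro X hX
    have h2 := (hasFDerivAt_form_apply (ε := ε) A x).mul_const (2⁻¹ : ℝ)
    rw [dirDeriv_eq_fderiv hε hx h2.differentiableAt (fun y hy => by
      rw [halfLengthSq, lengthSq_linear hσ hy, div_eq_mul_inv]) hX, h2.fderiv]
    simp only [smul_apply, add_apply, ContinuousLinearMap.comp_apply, formL_apply,
      ContinuousLinearMap.flip_apply, form_comm ε (A X), smul_eq_mul, form_neg_left]
    rw [form_apply_swap hA]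
    ring
  rw [grad, tangentTrace_congr hε hx (B' := fun X Y => form ε (-(A (A x))) X • Y)
    (fun X Y hX _ => by rw [h1 X hX]), tangentTrace_smul hε hx, proj]
  rw [form_neg_left, form_comm ε _ x, form_apply_swap hA]
  simp

theorem cov_grad_linear (hε : ε = 1 ∨ ε = -1)
    (hA : ∀ X Y, form ε (A X) Y + form ε X (A Y) = 0)
    (hσ : ∀ x ∈ space ε n, σ x = A x) (hx : x ∈ space ε n) :
    cov ε σ x (grad ε (halfLengthSq ε σ) x) =
      -(A (A (A x))) - (ε * form ε (A x) (A x)) • A x := by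
  have he := sq_eq_one hε
  have h1 : form ε x (A (A x)) = -form ε (A x) (A x) := form_apply_swap hA _ _
  rw [grad_linear hε hA hσ hx, cov_linear hε hσ hx]
  · have h2 : form ε x (A (A (A x))) = 0 := by
      rw [form_apply_swap hA, form_comm, form_apply_self hA, neg_zero]
    rw [map_sub, map_neg, map_smul, sub_eq_add_neg, proj_add, ← neg_smul, proj_smul,
      proj_apply_self hA, proj_of_tangent (by simp [h2])]
  · simp only [form_sub_right, form_neg_right, h1, form_smul_right, hx.1]
    linear_combination (-form ε (A x) (A x)) * he

theorem lengthSq_grad_linear (hε : ε = 1 ∨ ε = -1)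
    (hA : ∀ X Y, form ε (A X) Y + form ε X (A Y) = 0)
    (hσ : ∀ x ∈ space ε n, σ x = A x) (hx : x ∈ space ε n) :
    lengthSq ε (grad ε (halfLengthSq ε σ)) x =
      form ε (A (A x)) (A (A x)) - ε * form ε (A x) (A x) ^ 2 := by
  have he := sq_eq_one hε
  have h1 : form ε x (A (A x)) = -form ε (A x) (A x) := form_apply_swap hA _ _
  rw [lengthSq, grad_linear hε hA hσ hx]
  simp only [form_sub_right, form_neg_right, h1, form_smul_right, hx.1, form_sub_left,
    form_neg_left, form_smul_left, form_comm ε _ x]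
  linear_combination (ε * form ε (A x) (A x) ^ 2) * he

/-- On tangent X one has |∇_Xσ|² = |AX|² - ε⟨Ax, X⟩². The trace of the first term is -tr A² -
ε|Ax|², that of the second is -ε|Ax|². -/
theorem covNormSq_linear (hε : ε = 1 ∨ ε = -1)
    (hA : ∀ X Y, form ε (A X) Y + form ε X (A Y) = 0)
    (hσ : ∀ x ∈ space ε n, σ x = A x) (hx : x ∈ space ε n) :
    covNormSq ε σ x = -LinearMap.trace ℝ (Ambient n) (A * A).toLinearMap
      - 2 * (ε * form ε (A x) (A x)) := by
  have he := sq_eq_one hε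
  have h1 : ∀ X Y, form ε x X = 0 → form ε x Y = 0 →
      form ε (cov ε σ x X) (cov ε σ x Y) = (-1 : ℝ) • form ε ((A * A).toLinearMap X) Y +
        (-ε) • form ε (((formL ε n (A x)).toLinearMap.smulRight (A x)) X) Y := by
    intro X Y hX hY
    have h2 : form ε ((A * A).toLinearMap X) Y = -form ε (A X) (A Y) := by
      rw [form_apply_swap hA, neg_neg]; rfl
    rw [cov_linear hε hσ hx hX, cov_linear hε hσ hx hY, h2]
    simp only [proj, form_sub_left, form_sub_right, form_smul_left, form_smul_right, hx.1,
      LinearMap.smulRight_apply, ContinuousLinearMap.coe_coe, formL_apply, form_comm ε _ x,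
      form_apply_swap hA x, smul_eq_mul]
    linear_combination (ε * form ε (A x) X * form ε (A x) Y) * he
  rw [covNormSq, tangentTrace_congr hε hx h1, tangentTrace_add ε x
    (fun X Y => (-1 : ℝ) • form ε ((A * A).toLinearMap X) Y)
    (fun X Y => (-ε) • form ε (((formL ε n (A x)).toLinearMap.smulRight (A x)) X) Y),
    tangentTrace_const_smul, tangentTrace_const_smul, tangentTrace_form hε hx,
    tangentTrace_form hε hx, LinearMap.trace_smulRight]
  have h4 : form ε ((A * A).toLinearMap x) x = -form ε (A x) (A x) := by
    rw [form_comm]; exact form_apply_swap hA _ _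
  rw [h4]
  simp only [smul_eq_mul, LinearMap.smulRight_apply, ContinuousLinearMap.coe_coe, formL_apply,
    form_apply_self hA, form_smul_left]
  ring

/-- On tangent vectors the Hessian of F is the form ⟨-A²X, Y⟩ - ε|Ax|²⟨X, Y⟩; the derivative of the
coefficient of x in ∇F is purely normal and drops out. -/
theorem laplacian_linear (hε : ε = 1 ∨ ε = -1)
    (hA : ∀ X Y, form ε (A X) Y + form ε X (A Y) = 0)
    (hσ : ∀ x ∈ space ε n, σ x = A x) (hx : x ∈ space ε n) :
    laplacian ε (halfLengthSq ε σ) x = ε * (n + 1) * form ε (A x) (A x)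
      + LinearMap.trace ℝ (Ambient n) (A * A).toLinearMap := by
  have he := sq_eq_one hε
  have h1 : ∀ X Y, form ε x X = 0 → form ε x Y = 0 →
      form ε (cov ε (grad ε (halfLengthSq ε σ)) x X) Y =
      (-1 : ℝ) • form ε ((A * A).toLinearMap X) Y
        + (-(ε * form ε (A x) (A x))) • (form ε X Y • (1 : ℝ)) := by
    intro X Y hX hY
    have h2 : HasFDerivAt (fun y => -(A (A y)) - (ε * form ε (A y) (A y)) • y) _ x :=
      ((A.hasFDerivAt.comp x A.hasFDerivAt).neg).sub
        (((hasFDerivAt_form_apply (ε := ε) A x).const_mul ε).smul (hasFDerivAt_id x))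
    have h3 : ∀ Z, form ε (proj ε x Z) Y = form ε Z Y := fun Z => by
      rw [proj, form_sub_left, form_smul_left, hY]; ring
    rw [cov, dirDeriv_eq_fderiv hε hx h2.differentiableAt
      (fun y hy => grad_linear hε hA hσ hy) hX, h2.fderiv, h3]
    simp [formL_apply, hY]
    ring
  rw [laplacian, divergence, tangentTrace_congr hε hx h1, tangentTrace_add ε x
    (fun X Y => (-1 : ℝ) • form ε ((A * A).toLinearMap X) Y)
    (fun X Y => (-(ε * form ε (A x) (A x))) • (form ε X Y • (1 : ℝ))),
    tangentTrace_const_smul, tangentTrace_const_smul, tangentTrace_form hε hx,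
    tangentTrace_form_smul hε hx]
  have h4 : form ε ((A * A).toLinearMap x) x = -form ε (A x) (A x) := by
    rw [form_comm]; exact form_apply_swap hA _ _
  rw [h4]
  simp only [smul_eq_mul]
  ring

end Linear

section Linear

variable {ε : ℝ} {A : Ambient n →L[ℝ] Ambient n} {σ : Ambient n → Ambient n}

/-! ### The Euler-Lagrange equation for linear Killing fields -/

theorem tension_linear (hε : ε = 1 ∨ ε = -1)
    (hA : ∀ X Y, form ε (A X) Y + form ε X (A Y) = 0) (hσ : ∀ x ∈ space ε n, σ x = A x)
    {s : ℝ} (hs : LinearMap.trace ℝ (Ambient n) (A * A).toLinearMap = -s)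
    (p q : ℝ) {x : Ambient n} (hx : x ∈ space ε n) {f a : ℝ} (hf : form ε (A x) (A x) = f)
    (ha : form ε (A (A x)) (A (A x)) = a) :
    tensionT ε p σ x - tensionPhi ε p q σ x • σ x =
      ((1 + f) * (ε * (n - 1)) - 2 * p * (ε * f) - (p * (s - 2 * (ε * f)) -
        p * q * (a - ε * f ^ 2) - q * (1 + f) * (ε * (n + 1) * f - s))) • A x
      - (2 * p) • A (A (A x)) := by
  rw [tensionT, tensionPhi, lengthSq_linear hσ hx, roughLaplacian_linear hε hA hσ hx,
    cov_grad_linear hε hA hσ hx, covNormSq_linear hε hA hσ hx, lengthSq_grad_linear hε hA hσ hx,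
    laplacian_linear hε hA hσ hx, hσ x hx, hs, hf, ha]
  module

/-- A connected subset of the line with two points is infinite. This turns non-constant length into
vanishing of polynomial coefficients. -/
theorem infinite_lengthSq (hε : ε = 1 ∨ ε = -1) (hn : 1 ≤ n) (hσ : ∀ x ∈ space ε n, σ x = A x)
    (hc : ¬ HasConstantLength ε σ) :
    ((fun x => form ε (A x) (A x)) '' space ε n).Infinite := by
  apply IsPreconnected.infinite_of_nontrivial
  · refine (isPreconnected_space hε hn).image _ (Continuous.continuousOn ?_)
    unfold form; fun_prop
  · by_contra h
    rw [Set.not_nontrivial_iff] at h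
    apply hc
    rcases (space ε n).eq_empty_or_nonempty with h0 | ⟨x₀, hx₀⟩
    · exact ⟨0, fun x hx => by simp [h0] at hx⟩
    · refine ⟨form ε (A x₀) (A x₀), fun x hx => ?_⟩
      rw [lengthSq_linear hσ hx]
      exact h ⟨x, hx, rfl⟩ ⟨x₀, hx₀, rfl⟩

/-- The value t = 0 is exempt because the scalar multiplies Ax, so the equation says nothing where σ
vanishes. -/
theorem quadratic_coeff_eq_zero {S : Set ℝ} (hS : S.Infinite) {c₀ c₁ c₂ : ℝ}
    (h : ∀ t ∈ S, t ≠ 0 → c₀ + c₁ * t + c₂ * t ^ 2 = 0) : c₀ = 0 ∧ c₁ = 0 ∧ c₂ = 0 := by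
  open Polynomial in
  have h1 : (C c₀ + C c₁ * X + C c₂ * X ^ 2 : ℝ[X]) = 0 := by
    apply Polynomial.eq_zero_of_infinite_isRoot
    refine (hS.sdiff (Set.finite_singleton 0)).mono ?_
    rintro t ⟨ht, ht0⟩
    simpa [IsRoot] using h t ht ht0
  refine ⟨?_, ?_, ?_⟩
  · simpa using congrArg (fun P => P.coeff 0) h1
  · simpa [Polynomial.coeff_X, Polynomial.coeff_C] using congrArg (fun P => P.coeff 1) h1
  · simpa [Polynomial.coeff_X, Polynomial.coeff_C] using congrArg (fun P => P.coeff 2) h1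

theorem form_apply_apply {μ : ℝ} (hA : ∀ X Y, form ε (A X) Y + form ε X (A Y) = 0)
    (hμ : ∀ X, A (A (A X)) = μ • A X) (x : Ambient n) :
    form ε (A (A x)) (A (A x)) = -μ * form ε (A x) (A x) := by
  rw [form_apply_swap hA, hμ, form_smul_left]; ring

/-- For a Killing field with minimal polynomial dividing `t³ - μt` the Euler-Lagrange equation
amounts to three scalar equations. -/
theorem isPQHarmonic_iff (hε : ε = 1 ∨ ε = -1) (hn : 2 ≤ n)
    (hA : ∀ X Y, form ε (A X) Y + form ε X (A Y) = 0) (hσ : ∀ x ∈ space ε n, σ x = A x)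
    (hc : ¬ HasConstantLength ε σ) {μ : ℝ} (hμ : ∀ X, A (A (A X)) = μ • A X)
    {s : ℝ} (hs : LinearMap.trace ℝ (Ambient n) (A * A).toLinearMap = -s) (p q : ℝ) :
    IsPQHarmonic ε p q σ ↔ q * (n + 1 - p) = 0 ∧ ε * (n - 1) - p * q * μ + q * (ε * (n + 1) - s) = 0
      ∧ ε * (n - 1) - p * s - q * s - 2 * p * μ = 0 := by
  have key : ∀ x ∈ space ε n, tensionT ε p σ x - tensionPhi ε p q σ x • σ x =
      ((ε * (n - 1) - p * s - q * s - 2 * p * μ)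
        + (ε * (n - 1) - p * q * μ + q * (ε * (n + 1) - s)) * form ε (A x) (A x)
        + (ε * (q * (n + 1 - p))) * form ε (A x) (A x) ^ 2) • A x := by
    intro x hx
    rw [tension_linear hε hA hσ hs p q hx rfl rfl, form_apply_apply hA hμ, hμ]
    module
  constructor
  · intro h
    obtain ⟨h0, h1, h2⟩ := quadratic_coeff_eq_zero (infinite_lengthSq hε (by omega) hσ hc)
      (c₀ := ε * (n - 1) - p * s - q * s - 2 * p * μ)
      (c₁ := ε * (n - 1) - p * q * μ + q * (ε * (n + 1) - s)) (c₂ := ε * (q * (n + 1 - p))) (by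
        rintro _ ⟨x, hx, rfl⟩ h0
        have h1 := h x hx
        rw [key x hx, smul_eq_zero] at h1
        refine h1.resolve_right fun h2 => h0 ?_
        simp [h2])
    refine ⟨?_, h1, h0⟩
    rcases mul_eq_zero.mp h2 with h3 | h3
    · rcases hε with rfl | rfl <;> norm_num at h3
    · exact h3
  · rintro ⟨h2, h1, h0⟩ x hx
    rw [key x hx, h0, h1, h2]
    simp

/-- The equation makes A³x a multiple of Ax at each point of M. Vanishing 2×2 minors carry this to
all vectors, so every vector of the range of A is an eigenvector of A², which is therefore scalar
there. -/
theorem exists_cubic (hε : ε = 1 ∨ ε = -1) (hn : 2 ≤ n)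
    (hA : ∀ X Y, form ε (A X) Y + form ε X (A Y) = 0) (hσ : ∀ x ∈ space ε n, σ x = A x)
    (hc : ¬ HasConstantLength ε σ) {p q : ℝ} (h : IsPQHarmonic ε p q σ) :
    ∃ μ : ℝ, ∀ X, A (A (A X)) = μ • A X := by
  obtain ⟨s, hs⟩ : ∃ s, LinearMap.trace ℝ (Ambient n) (A * A).toLinearMap = -s :=
    ⟨_, (neg_neg _).symm⟩
  have hn' : (2 : ℝ) ≤ n := by exact_mod_cast hn
  -- For p = 0 the A³ term is absent and the scalar alone must vanish: its top coefficient gives q =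
  -- 0, and its constant term then gives ε(n-1) = 0.
  have hp : p ≠ 0 := by
    rintro rfl
    obtain ⟨h0, h1, h2⟩ := quadratic_coeff_eq_zero (infinite_lengthSq hε (by omega) hσ hc)
      (c₀ := ε * (n - 1) - q * s)
      (c₁ := ε * (n - 1) + q * (ε * (n + 1) - s)) (c₂ := ε * (q * (n + 1))) (by
        rintro _ ⟨x, hx, rfl⟩ h0
        have h1 := h x hx
        rw [tension_linear hε hA hσ hs 0 q hx rfl rfl, mul_zero, zero_smul, sub_zero,
          smul_eq_zero] at h1
        have := h1.resolve_right fun h2 => h0 (by simp [h2])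
        linear_combination this)
    have hε0 : ε ≠ 0 := by rcases hε with rfl | rfl <;> norm_num
    have hq : q = 0 := by
      have h3 := (mul_eq_zero.mp h2).resolve_left hε0
      exact (mul_eq_zero.mp h3).resolve_right (by linarith)
    rw [hq, zero_mul, sub_zero] at h0
    have := (mul_eq_zero.mp h0).resolve_left hε0
    linarith
  have hspace : ∀ x ∈ space ε n, ∃ l : ℝ, A (A (A x)) = l • A x := by
    intro x hx
    have h1 := h x hx
    rw [tension_linear hε hA hσ hs p q hx rfl rfl, sub_eq_zero] at h1
    have h2 := congrArg (fun v => (2 * p)⁻¹ • v) h1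
    simp only [smul_smul] at h2
    rw [inv_mul_cancel₀ (by simpa using hp), one_smul] at h2
    exact ⟨_, h2.symm⟩
  have hcone : ∀ y ∈ cone ε n, ∀ i j, A (A (A y)) i * A y j = A (A (A y)) j * A y i := by
    intro y hy i j
    obtain ⟨l, hl⟩ := hspace _ (radial_mem hε hy)
    rw [← radius_smul_radial hy]
    simp only [map_smul, hl, PiLp.smul_apply, smul_eq_mul]
    ring
  -- The minors are quadratic in v. Their second difference along x₀ ± (δ/2)v, inside the open cone,
  -- isolates the value at v.
  have hall : ∀ v i j, A (A (A v)) i * A v j = A (A (A v)) j * A v i := by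
    intro v i j
    obtain ⟨_, x₀, hx₀, -⟩ := (infinite_lengthSq hε (by omega) hσ hc).nonempty
    have hcont : Continuous fun t : ℝ => x₀ + t • v := by fun_prop
    have hnear : ∀ᶠ t : ℝ in nhds 0, x₀ + t • v ∈ cone ε n :=
      hcont.continuousAt.eventually_mem ((isOpen_cone ε).mem_nhds (by
        simpa using space_subset_cone hε hx₀))
    obtain ⟨δ, hδ, hball⟩ := Metric.eventually_nhds_iff.mp hnear
    have e1 := hcone _ (@hball (δ / 2) (by simp [abs_of_pos hδ]; linarith)) i j
    have e2 := hcone _ (@hball (-(δ / 2)) (by simp [abs_of_pos hδ]; linarith)) i j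
    have e3 := hcone _ (space_subset_cone hε hx₀) i j
    simp only [map_add, map_smul, PiLp.add_apply, PiLp.smul_apply, smul_eq_mul] at e1 e2
    have hd : δ ^ 2 ≠ 0 := by positivity
    apply mul_left_cancel₀ hd
    linear_combination 2 * e1 + 2 * e2 - 4 * e3
  let W := LinearMap.range A.toLinearMap
  let T : W →ₗ[ℝ] W := (A * A).toLinearMap.restrict (fun w _ => ⟨A w, rfl⟩)
  obtain ⟨μ, hμ⟩ := T.exists_eq_smul_id_of_forall_notLinearIndependent (fun w => by
    obtain ⟨_, v, rfl⟩ := w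
    rw [LinearIndependent.pair_iff]
    intro hli
    have hj : ∀ j, A v j = 0 := by
      intro j
      have := (hli (A (A (A v)) j) (-(A v j)) (by
        apply Subtype.ext
        ext i
        have := hall v i j
        change A (A (A v)) j * A v i + -(A v j) * A (A (A v)) i = 0
        linarith)).2
      linarith
    have h0 : A v = 0 := by ext j; exact hj j
    have := (hli 1 0 (by apply Subtype.ext; simp [h0])).1
    norm_num at this)
  refine ⟨μ, fun X => ?_⟩
  have := congrArg (fun L : W →ₗ[ℝ] W => ((L ⟨A X, X, rfl⟩ : W) : Ambient n)) hμ
  simpa [T] using this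

end Linear

end SpaceForm

/-! ### Bases adapted to a bilinear form and a complex structure -/

section Bases

variable {F : Type*} [AddCommGroup F] [Module ℝ F] [FiniteDimensional ℝ F]
  (B : F →ₗ[ℝ] F →ₗ[ℝ] ℝ)

theorem exists_orthonormal_of_posDef (hsymm : ∀ x y, B x y = B y x)
    (hpos : ∀ x, x ≠ 0 → 0 < B x x) :
    ∃ g : Fin (Module.finrank ℝ F) → F, ∀ i j, B (g i) (g j) = if i = j then 1 else 0 := by
  let core : InnerProductSpace.Core ℝ F :=
    { inner := fun x y => B x y
      conj_inner_symm := fun x y => by simpa using hsymm y x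
      re_inner_nonneg := fun x => by
        by_cases h : x = 0
        · simp [h]
        · simpa using (hpos x h).le
      add_left := fun x y z => by simp
      smul_left := fun x y r => by simp
      definite := fun x h => by
        by_contra h0
        exact (hpos x h0).ne' h }
  let _ : NormedAddCommGroup F := core.toNormedAddCommGroup
  let _ : InnerProductSpace ℝ F := InnerProductSpace.ofCore core.toCore
  let b := stdOrthonormalBasis ℝ F
  exact ⟨b, fun i j => (orthonormal_iff_ite.mp b.orthonormal i j)⟩

/-- The complex vector space structure defined by an endomorphism of square `-1`. -/
abbrev complexModuleOf (J : F →ₗ[ℝ] F) (hJ : ∀ x, J (J x) = -x) : Module ℂ F where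
  smul z x := z.re • x + z.im • J x
  one_smul x := by
    change (1 : ℂ).re • x + (1 : ℂ).im • J x = x
    simp
  mul_smul z w x := by
    change (z * w).re • x + (z * w).im • J x =
      z.re • (w.re • x + w.im • J x) + z.im • J (w.re • x + w.im • J x)
    simp only [map_add, map_smul, hJ, Complex.mul_re, Complex.mul_im]
    module
  smul_zero z := by
    change z.re • (0 : F) + z.im • J 0 = 0
    simp
  smul_add z x y := by
    change z.re • (x + y) + z.im • J (x + y) = z.re • x + z.im • J x + (z.re • y + z.im • J y)
    rw [map_add]; module
  add_smul z w x := by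
    change (z + w).re • x + (z + w).im • J x = z.re • x + z.im • J x + (w.re • x + w.im • J x)
    rw [Complex.add_re, Complex.add_im]; module
  zero_smul x := by
    change (0 : ℂ).re • x + (0 : ℂ).im • J x = 0
    simp

/-- J makes F a complex vector space and B the real part of the Hermitian product B(x, y) + iB(Jx,
y). An orthonormal complex basis encodes both relations, as real and imaginary parts. -/
theorem exists_unitary_of_posDef (hsymm : ∀ x y, B x y = B y x)
    (hpos : ∀ x, x ≠ 0 → 0 < B x x) (J : F →ₗ[ℝ] F) (hJ : ∀ x, J (J x) = -x)
    (hskew : ∀ x y, B (J x) y = -B x (J y)) :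
    ∃ (r : ℕ) (g : Fin r → F), Module.finrank ℝ F = 2 * r ∧
      ∀ i j, B (g i) (g j) = (if i = j then 1 else 0) ∧ B (g i) (J (g j)) = 0 := by
  let _ : Module ℂ F := complexModuleOf J hJ
  have hsmul : ∀ (z : ℂ) (x : F), z • x = z.re • x + z.im • J x := fun _ _ => rfl
  have : IsScalarTower ℝ ℂ F := ⟨fun r z x => by
    rw [hsmul, hsmul, Complex.smul_re, Complex.smul_im, smul_eq_mul, smul_eq_mul]
    module⟩
  have : Module.Finite ℂ F := Module.Finite.of_restrictScalars_finite ℝ ℂ F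
  let core : InnerProductSpace.Core ℂ F :=
    { inner := fun x y => ⟨B x y, B (J x) y⟩
      conj_inner_symm := fun x y => by
        apply Complex.ext
        · exact hsymm y x
        · change -B (J y) x = B (J x) y
          rw [hskew, neg_neg, hsymm]
      re_inner_nonneg := fun x => by
        change 0 ≤ B x x
        by_cases h : x = 0
        · simp [h]
        · exact (hpos x h).le
      add_left := fun x y z => by
        apply Complex.ext <;> simp
      smul_left := fun x y r => by
        rw [hsmul]
        apply Complex.ext
        · simp
        · simp [hJ]
      definite := fun x h => by
        by_contra h0
        exact (hpos x h0).ne' (congrArg Complex.re h) }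
  have hfin : Module.finrank ℝ F = 2 * Module.finrank ℂ F := by
    rw [← Module.finrank_mul_finrank ℝ ℂ F, Complex.finrank_real_complex]
  let _ : NormedAddCommGroup F := core.toNormedAddCommGroup
  let _ : InnerProductSpace ℂ F := InnerProductSpace.ofCore core.toCore
  let b := stdOrthonormalBasis ℂ F
  refine ⟨_, b, hfin, fun i j => ?_⟩
  have h := orthonormal_iff_ite.mp b.orthonormal i j
  have hre : B (b i) (b j) = _ := congrArg Complex.re h
  have him : B (J (b i)) (b j) = _ := congrArg Complex.im h
  rw [hskew] at him
  constructor
  · rw [hre]; split_ifs <;> rfl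
  · have : (if i = j then (1 : ℂ) else 0).im = 0 := by split_ifs <;> rfl
    linarith

end Bases

namespace SpaceForm

variable {n : ℕ}

section Linear

variable {ε : ℝ} {A : Ambient n →L[ℝ] Ambient n} {σ : Ambient n → Ambient n}

/-! ### Normal form of elliptic Killing fields -/

/-- The ambient inner product restricted to a subspace. -/
def formOn (ε : ℝ) (W : Submodule ℝ (Ambient n)) : W →ₗ[ℝ] W →ₗ[ℝ] ℝ :=
  LinearMap.mk₂ ℝ (fun x y => form ε (x : Ambient n) (y : Ambient n)) (by intros; simp)
    (by intros; simp) (by intros; simp) (by intros; simp)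

theorem form_range_of_ker (hA : ∀ X Y, form ε (A X) Y + form ε X (A Y) = 0) {τ : Ambient n}
    (hτ : A τ = 0) (X : Ambient n) : form ε τ (A X) = 0 := by
  rw [form_apply_swap hA, hτ]; simp

/-- The range of A is orthogonal to the zero τ, hence spacelike, and w⁻¹A squares to -1 on it and is
skew. Indexing by ℕ with default value 0 avoids casts between `Fin` types. -/
theorem exists_unitary_range (hε : ε = 1 ∨ ε = -1)
    (hA : ∀ X Y, form ε (A X) Y + form ε X (A Y) = 0) {w : ℝ} (hw : 0 < w)
    (hμ : ∀ X, A (A (A X)) = (-w ^ 2) • A X) {τ : Ambient n} (hτ : τ ∈ space ε n)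
    (hAτ : A τ = 0) :
    ∃ (r : ℕ) (g : ℕ → Ambient n), Module.finrank ℝ (LinearMap.range A.toLinearMap) = 2 * r ∧
      (∀ a, g a ∈ LinearMap.range A.toLinearMap) ∧
      ∀ a < r, ∀ b < r, form ε (g a) (g b) = (if a = b then 1 else 0) ∧
        form ε (g a) (A (g b)) = 0 := by
  set W := LinearMap.range A.toLinearMap
  let J : W →ₗ[ℝ] W := (w⁻¹ • A.toLinearMap).restrict (fun x _ => W.smul_mem _ ⟨x, rfl⟩)
  have hJ : ∀ x : W, ((J x : W) : Ambient n) = w⁻¹ • A x := fun x => rfl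
  obtain ⟨r, g, hr, hg⟩ := exists_unitary_of_posDef (formOn ε W) (fun x y => form_comm ε _ _)
    (fun x hx => by
      obtain ⟨_, v, rfl⟩ := x
      exact form_self_pos_of_tangent hε hτ (form_range_of_ker hA hAτ v)
        fun h => hx (Subtype.ext h)) J
    (fun x => by
      obtain ⟨_, v, rfl⟩ := x
      apply Subtype.ext
      rw [hJ, hJ]
      simp only [map_smul, ContinuousLinearMap.coe_coe, hμ, smul_smul, Submodule.coe_neg]
      rw [← neg_one_smul ℝ (A v)]
      congr 1
      field_simp)
    (fun x y => by
      change form ε (w⁻¹ • A x) y = -form ε x (w⁻¹ • A y)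
      rw [form_smul_left, form_smul_right, form_apply_swap hA]; ring)
  refine ⟨r, fun a => if h : a < r then g ⟨a, h⟩ else 0, hr, fun a => ?_, fun a ha b hb => ?_⟩
  · by_cases h : a < r
    · simp [h]
    · simp [h]
  · simp only [ha, hb, dif_pos]
    have h := hg ⟨a, ha⟩ ⟨b, hb⟩
    simp only [Fin.mk.injEq] at h
    refine ⟨h.1, ?_⟩
    have h2 : form ε (g ⟨a, ha⟩) (w⁻¹ • A (g ⟨b, hb⟩)) = 0 := h.2
    rw [form_smul_right] at h2
    exact (mul_eq_zero.mp h2).resolve_left (inv_ne_zero hw.ne')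

theorem exists_orthonormal_ker (hε : ε = 1 ∨ ε = -1) {τ : Ambient n} (hτ : τ ∈ space ε n)
    (hAτ : A τ = 0) {r : ℕ} (hr : Module.finrank ℝ (LinearMap.range A.toLinearMap) = 2 * r) :
    2 * r ≤ n ∧ ∃ h : ℕ → Ambient n, (∀ a, A (h a) = 0) ∧ (∀ a, form ε τ (h a) = 0) ∧
      ∀ a < n - 2 * r, ∀ b < n - 2 * r, form ε (h a) (h b) = if a = b then 1 else 0 := by
  have he := sq_eq_one hε
  let N := LinearMap.ker A.toLinearMap
  -- The frame is taken in the kernel of this functional: the complement of τ in ker A, spacelike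
  -- and of dimension (n + 1 - 2r) - 1.
  let l : N →ₗ[ℝ] ℝ := (formL ε n τ).toLinearMap.domRestrict N
  have hl : Function.Surjective l := by
    intro c
    refine ⟨⟨(c * ε) • τ, ?_⟩, ?_⟩
    · simp [N, hAτ]
    · change form ε τ ((c * ε) • τ) = c
      rw [form_smul_right, hτ.1, mul_assoc, he, mul_one]
  have h1 := LinearMap.finrank_range_add_finrank_ker A.toLinearMap
  have h2 := LinearMap.finrank_range_add_finrank_ker l
  rw [LinearMap.range_eq_top.mpr hl, finrank_top, Module.finrank_self] at h2
  rw [finrank_euclideanSpace_fin, hr] at h1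
  have h3 : Module.finrank ℝ (LinearMap.ker l) = n - 2 * r := by
    have : Module.finrank ℝ N = Module.finrank ℝ (LinearMap.ker A.toLinearMap) := rfl
    omega
  refine ⟨by
    have : Module.finrank ℝ N = Module.finrank ℝ (LinearMap.ker A.toLinearMap) := rfl
    omega, ?_⟩
  let U := LinearMap.ker l
  obtain ⟨g, hg⟩ := exists_orthonormal_of_posDef
    ((formOn ε N).domRestrict₁₂ U U) (fun x y => form_comm ε _ _)
    (fun x hx => form_self_pos_of_tangent hε hτ (LinearMap.mem_ker.mp x.2)
      fun h => hx (Subtype.ext (Subtype.ext h)))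
  have hlt : ∀ {a}, a < n - 2 * r → a < Module.finrank ℝ U := fun ha => ha.trans_eq h3.symm
  refine ⟨fun a => if h : a < Module.finrank ℝ U then ((g ⟨a, h⟩ : N) : Ambient n) else 0,
    fun a => ?_, fun a => ?_, fun a ha b hb => ?_⟩
  · by_cases h : a < Module.finrank ℝ U
    · simp only [h, dif_pos]
      exact LinearMap.mem_ker.mp (g ⟨a, h⟩ : N).2
    · simp [h]
  · by_cases h : a < Module.finrank ℝ U
    · simp only [h, dif_pos]
      exact LinearMap.mem_ker.mp (g ⟨a, h⟩).2
    · simp [h]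
  · simp only [hlt ha, hlt hb, dif_pos]
    have h := hg ⟨a, hlt ha⟩ ⟨b, hlt hb⟩
    simp only [Fin.mk.injEq] at h
    exact h

theorem exists_adapted_frame (hε : ε = 1 ∨ ε = -1)
    (hA : ∀ X Y, form ε (A X) Y + form ε X (A Y) = 0) {w : ℝ} (hw : 0 < w)
    (hμ : ∀ X, A (A (A X)) = (-w ^ 2) • A X) {τ : Ambient n} (hτ : τ ∈ space ε n)
    (hAτ : A τ = 0) :
    ∃ (r : ℕ) (f : ℕ → Ambient n), Module.finrank ℝ (LinearMap.range A.toLinearMap) = 2 * r ∧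
      2 * r ≤ n ∧ f n = τ ∧ (∀ a < r, A (f (2 * a)) = w • f (2 * a + 1)) ∧
      (∀ a < r, A (f (2 * a + 1)) = (-w) • f (2 * a)) ∧ (∀ i, 2 * r ≤ i → A (f i) = 0) ∧
      ∀ i ≤ n, ∀ j ≤ n, form ε (f i) (f j) =
        if i = j then (if i = n then ε else 1) else 0 := by
  obtain ⟨r, g, hr, hgW, hg⟩ := exists_unitary_range hε hA hw hμ hτ hAτ
  obtain ⟨hrn, h, hh0, hhτ, hh⟩ := exists_orthonormal_ker hε hτ hAτ hr
  have hAA : ∀ a, A (A (g a)) = (-w ^ 2) • g a := fun a => by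
    obtain ⟨v, hv⟩ := hgW a
    have hv' : A v = g a := hv
    rw [← hv', hμ]
  have hgh : ∀ a b, form ε (g a) (h b) = 0 := fun a b => by
    obtain ⟨v, hv⟩ := hgW a
    have hv' : A v = g a := hv
    rw [← hv', form_comm]
    exact form_range_of_ker hA (hh0 b) v
  have hgτ : ∀ a, form ε (g a) τ = 0 := fun a => by
    obtain ⟨v, hv⟩ := hgW a
    have hv' : A v = g a := hv
    rw [← hv', form_comm]
    exact form_range_of_ker hA hAτ v
  have hAgh : ∀ a b, form ε (A (g a)) (h b) = 0 := fun a b => by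
    rw [form_comm]
    exact form_range_of_ker hA (hh0 b) _
  have hAgτ : ∀ a, form ε (A (g a)) τ = 0 := fun a => by
    rw [form_comm]
    exact form_range_of_ker hA hAτ _
  have hAgAg : ∀ a < r, ∀ b < r, form ε (A (g a)) (A (g b)) = if a = b then w ^ 2 else 0 := by
    intro a ha b hb
    rw [form_apply_swap hA, hAA, form_smul_left, (hg a ha b hb).1]
    split_ifs <;> ring
  -- The order matches the standard basis: r rotation planes spanned by g and w⁻¹Ag, then the rest
  -- of ker A, and τ in the last, possibly timelike, place n.
  let f : ℕ → Ambient n := fun i =>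
    if i < 2 * r then (if i % 2 = 0 then g (i / 2) else w⁻¹ • A (g (i / 2)))
    else if i < n then h (i - 2 * r) else τ
  have f0 : ∀ a < r, f (2 * a) = g a := fun a ha => by
    simp only [f]
    rw [if_pos (by omega), if_pos (by omega)]
    congr 1; omega
  have f1 : ∀ a < r, f (2 * a + 1) = w⁻¹ • A (g a) := fun a ha => by
    simp only [f]
    rw [if_pos (by omega), if_neg (by omega), show (2 * a + 1) / 2 = a by omega]
  have f2 : ∀ a, a < n - 2 * r → f (2 * r + a) = h a := fun a ha => by
    simp only [f]
    rw [if_neg (by omega), if_pos (by omega)]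
    congr 1; omega
  have f3 : f n = τ := by
    simp only [f]
    rw [if_neg (by omega), if_neg (by omega)]
  have hw0 := hw.ne'
  refine ⟨r, f, hr, hrn, f3, fun a ha => ?_, fun a ha => ?_, fun i hi => ?_, ?_⟩
  · rw [f0 a ha, f1 a ha, smul_smul, mul_inv_cancel₀ hw0, one_smul]
  · rw [f0 a ha, f1 a ha, map_smul, hAA, smul_smul]
    congr 1; field_simp
  · simp only [f]
    rw [if_neg (by omega)]
    split_ifs
    · exact hh0 _
    · exact hAτ
  · have kinds : ∀ i ≤ n, (∃ a < r, i = 2 * a) ∨ (∃ a < r, i = 2 * a + 1) ∨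
        (∃ a < n - 2 * r, i = 2 * r + a) ∨ i = n := by
      intro i hi
      by_cases h1 : i < 2 * r
      · by_cases h2 : i % 2 = 0
        · exact Or.inl ⟨i / 2, by omega, by omega⟩
        · exact Or.inr (Or.inl ⟨i / 2, by omega, by omega⟩)
      · by_cases h2 : i < n
        · exact Or.inr (Or.inr (Or.inl ⟨i - 2 * r, by omega, by omega⟩))
        · exact Or.inr (Or.inr (Or.inr (by omega)))
    have key : ∀ i ≤ n, ∀ j ≤ n, i ≤ j → form ε (f i) (f j) =
        if i = j then (if i = n then ε else 1) else 0 := by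
      intro i hi j hj hij
      rcases kinds i hi with ⟨a, ha, rfl⟩ | ⟨a, ha, rfl⟩ | ⟨a, ha, rfl⟩ | rfl <;>
      rcases kinds j hj with ⟨b, hb, rfl⟩ | ⟨b, hb, rfl⟩ | ⟨b, hb, rfl⟩ | rfl
      · rw [f0 a ha, f0 b hb, (hg a ha b hb).1, if_neg (by omega : ¬ 2 * a = n)]
        simp
      · rw [f0 a ha, f1 b hb, form_smul_right, (hg a ha b hb).2, if_neg (by omega), mul_zero]
      · rw [f0 a ha, f2 b hb, hgh, if_neg (by omega)]
      · rw [f0 a ha, f3, hgτ, if_neg (by omega)]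
      · rw [f1 a ha, f0 b hb, form_smul_left, form_comm, (hg b hb a ha).2, if_neg (by omega),
          mul_zero]
      · rw [f1 a ha, f1 b hb, form_smul_left, form_smul_right, hAgAg a ha b hb,
          if_neg (by omega : ¬ 2 * a + 1 = n)]
        by_cases hab : a = b
        · simp only [hab, if_true]; field_simp
        · rw [if_neg hab, if_neg (by omega)]; ring
      · rw [f1 a ha, f2 b hb, form_smul_left, hAgh, if_neg (by omega), mul_zero]
      · rw [f1 a ha, f3, form_smul_left, hAgτ, if_neg (by omega), mul_zero]
      · omega
      · omega
      · rw [f2 a ha, f2 b hb, hh a ha b hb, if_neg (by omega : ¬ 2 * r + a = n)]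
        simp
      · rw [f2 a ha, f3, form_comm, hhτ, if_neg (by omega)]
      · omega
      · omega
      · omega
      · rw [f3, hτ.1]; simp
    intro i hi j hj
    rcases le_total i j with hij | hij
    · exact key i hi j hj hij
    · rw [form_comm, key j hj i hi hij]
      by_cases h : i = j
      · simp [h]
      · rw [if_neg h, if_neg (Ne.symm h)]

end Linear

/-! ### The generalised Hopf fields -/

/-- The generalised Hopf field as a linear map. -/
def hopfLinear (n r : ℕ) : Ambient n →ₗ[ℝ] Ambient n where
  toFun := hopfField r
  map_add' x y := by
    ext i
    simp only [hopfField, PiLp.add_apply]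
    split_ifs <;> ring
  map_smul' c x := by
    ext i
    simp only [hopfField, PiLp.smul_apply, smul_eq_mul, RingHom.id_apply]
    split_ifs <;> ring

theorem hopfLinear_apply (r : ℕ) (x : Ambient n) : hopfLinear n r x = hopfField r x := rfl

theorem hopfField_single_even {r a : ℕ} (ha : a < r) (hr : 2 * r < n + 1) :
    hopfField r (EuclideanSpace.single (⟨2 * a, by omega⟩ : Fin (n + 1)) (1 : ℝ)) =
      EuclideanSpace.single (⟨2 * a + 1, by omega⟩ : Fin (n + 1)) (1 : ℝ) := by
  ext i
  simp only [hopfField, PiLp.single_apply, Fin.ext_iff, Nat.even_iff]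
  split_ifs <;> first | omega | simp

theorem hopfField_single_odd {r a : ℕ} (ha : a < r) (hr : 2 * r < n + 1) :
    hopfField r (EuclideanSpace.single (⟨2 * a + 1, by omega⟩ : Fin (n + 1)) (1 : ℝ)) =
      -EuclideanSpace.single (⟨2 * a, by omega⟩ : Fin (n + 1)) (1 : ℝ) := by
  ext i
  simp only [hopfField, PiLp.single_apply, Fin.ext_iff, Nat.even_iff, PiLp.neg_apply]
  split_ifs <;> first | omega | simp

theorem hopfField_single_of_le {r : ℕ} (hr : 2 * r < n + 1) (i : Fin (n + 1)) (hi : 2 * r ≤ i) :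
    hopfField r (EuclideanSpace.single i (1 : ℝ)) = 0 := by
  ext j
  simp only [hopfField, PiLp.single_apply, Fin.ext_iff, Nat.even_iff, PiLp.zero_apply]
  split_ifs <;> first | omega | simp

theorem index_cases (r : ℕ) (hr : 2 * r < n + 1) (i : Fin (n + 1)) :
    (∃ (a : ℕ) (_ : a < r), i = ⟨2 * a, by omega⟩) ∨
      (∃ (a : ℕ) (_ : a < r), i = ⟨2 * a + 1, by omega⟩) ∨ 2 * r ≤ i := by
  by_cases h1 : i.val < 2 * r
  · by_cases h2 : i.val % 2 = 0
    · exact Or.inl ⟨i / 2, by omega, Fin.ext (by simp only; omega)⟩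
    · exact Or.inr (Or.inl ⟨i / 2, by omega, Fin.ext (by simp only; omega)⟩)
  · exact Or.inr (Or.inr (by omega))

theorem hopfLinear_sq_single {r : ℕ} (hr : 2 * r < n + 1) (i : Fin (n + 1)) :
    hopfLinear n r (hopfLinear n r (EuclideanSpace.single i 1)) =
      if i.val < 2 * r then -EuclideanSpace.single i 1 else 0 := by
  rcases index_cases r hr i with ⟨a, ha, rfl⟩ | ⟨a, ha, rfl⟩ | h
  · rw [hopfLinear_apply r (EuclideanSpace.single _ _), hopfField_single_even ha hr,
      hopfLinear_apply, hopfField_single_odd ha hr, if_pos (by simp only; omega)]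
  · rw [hopfLinear_apply r (EuclideanSpace.single _ _), hopfField_single_odd ha hr, map_neg,
      hopfLinear_apply, hopfField_single_even ha hr, if_pos (by simp only; omega)]
  · rw [hopfLinear_apply r (EuclideanSpace.single _ _), hopfField_single_of_le hr i h, map_zero,
      if_neg (by omega)]

theorem ext_single {f g : Ambient n →ₗ[ℝ] Ambient n}
    (h : ∀ i, f (EuclideanSpace.single i 1) = g (EuclideanSpace.single i 1)) : f = g := by
  refine (EuclideanSpace.basisFun (Fin (n + 1)) ℝ).toBasis.ext fun i => ?_
  simpa using h i

theorem hopfLinear_cubic {r : ℕ} (hr : 2 * r < n + 1) (x : Ambient n) :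
    hopfLinear n r (hopfLinear n r (hopfLinear n r x)) = -hopfLinear n r x := by
  have : hopfLinear n r ∘ₗ hopfLinear n r ∘ₗ hopfLinear n r = -hopfLinear n r := by
    refine ext_single fun i => ?_
    simp only [LinearMap.comp_apply, hopfLinear_sq_single hr, LinearMap.neg_apply]
    split_ifs with h
    · rw [map_neg]
    · rw [map_zero, hopfLinear_apply, hopfField_single_of_le hr i (by omega), neg_zero]
  exact LinearMap.congr_fun this x

theorem trace_hopfLinear_sq {r : ℕ} (hr : 2 * r < n + 1) :
    LinearMap.trace ℝ (Ambient n) (hopfLinear n r ∘ₗ hopfLinear n r) = -(2 * r) := by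
  rw [trace_eq_sum]
  have : ∀ i : Fin (n + 1), (hopfLinear n r ∘ₗ hopfLinear n r) (EuclideanSpace.single i 1) i =
      if i.val < 2 * r then (-1 : ℝ) else 0 := by
    intro i
    rw [LinearMap.comp_apply, hopfLinear_sq_single hr]
    split_ifs <;> simp
  simp only [this]
  rw [Fin.sum_univ_eq_sum_range (fun i => if i < 2 * r then (-1 : ℝ) else 0), ← Finset.sum_filter]
  have h2 : (Finset.range (n + 1)).filter (fun i => i < 2 * r) = Finset.range (2 * r) := by
    ext i; simp; omega
  rw [h2]
  simp

/-! ### Linear isometries -/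

/-- A vector of square -1 lies on one of the two sheets; on the lower sheet its product with x would
be positive. -/
theorem mem_space_of_form_neg {x v : Ambient n} (hx : x ∈ space (-1) n)
    (hv : form (-1) v v = -1) (h : form (-1) v x < 0) : v ∈ space (-1) n := by
  refine ⟨hv, fun _ => ?_⟩
  by_contra hneg
  rcases (not_lt.mp hneg).lt_or_eq with h1 | h1
  · have h2 : -v ∈ space (-1) n := ⟨by simp [hv], fun _ => by simpa using h1⟩
    have := form_neg_of_mem h2 hx
    rw [form_neg_left] at this
    linarith
  · have h0 : v ≠ 0 := by
      rintro rfl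
      simp at hv
    have := form_self_pos_of_last (ε := -1) h1 h0
    linarith

theorem single_last_mem_space {ε : ℝ} :
    EuclideanSpace.single (Fin.last n) (1 : ℝ) ∈ space ε n := by
  refine ⟨?_, fun _ => by simp⟩
  rw [form_single]
  simp [signature]

/-- A linear isometry moving one point of the space form into the space form preserves it. -/
theorem apply_mem_space {ε : ℝ} (hε : ε = 1 ∨ ε = -1) {L : Ambient n → Ambient n}
    (hL : ∀ x y, form ε (L x) (L y) = form ε x y) {x₀ : Ambient n} (h₀ : x₀ ∈ space ε n)
    (h₁ : L x₀ ∈ space ε n) {x : Ambient n} (hx : x ∈ space ε n) : L x ∈ space ε n := by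
  have h2 : form ε (L x) (L x) = ε := by rw [hL, hx.1]
  rcases hε with rfl | rfl
  · exact ⟨h2, fun h => by norm_num at h⟩
  · refine mem_space_of_form_neg h₁ h2 ?_
    rw [hL]
    exact form_neg_of_mem hx h₀

theorem dirDeriv_linear {ε : ℝ} (hε : ε = 1 ∨ ε = -1) {φ : Ambient n → Ambient n}
    {L : Ambient n →L[ℝ] Ambient n} (hφ : ∀ x ∈ space ε n, φ x = L x) {x X : Ambient n}
    (hx : x ∈ space ε n) (hX : form ε x X = 0) : dirDeriv ε φ x X = L X := by
  rw [dirDeriv_eq_fderiv hε hx L.differentiableAt hφ hX, L.fderiv]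

theorem isIsometry_of_linear {ε : ℝ} (hε : ε = 1 ∨ ε = -1) (L : Ambient n ≃L[ℝ] Ambient n)
    (hL : ∀ x y, form ε (L x) (L y) = form ε x y) {x₀ : Ambient n} (h₀ : x₀ ∈ space ε n)
    (h₁ : L x₀ ∈ space ε n) : IsIsometry ε L where
  bijOn := by
    refine ⟨fun x hx => apply_mem_space hε hL h₀ h₁ hx, L.injective.injOn, fun y hy => ?_⟩
    refine ⟨L.symm y, apply_mem_space hε (L := L.symm) (fun x y => ?_) h₁ ?_ hy, by simp⟩
    · rw [← hL]; simp
    · simpa using h₀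
  smooth x hx := L.contDiff.contDiffAt.comp x (contDiffAt_radial (space_subset_cone hε hx))
  metric x hx X hX Y hY := by
    have hφ : ∀ x ∈ space ε n, L x = (L : Ambient n →L[ℝ] Ambient n) x := fun _ _ => rfl
    rw [dirDeriv_linear hε hφ hx hX, dirDeriv_linear hε hφ hx hY]
    exact hL X Y

section Linear

variable {ε : ℝ} {A : Ambient n →L[ℝ] Ambient n} {σ : Ambient n → Ambient n}

/-- Elliptic Killing fields with a single rotation speed are congruent to twisted Hopf fields. -/
theorem exists_areCongruent (hε : ε = 1 ∨ ε = -1)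
    (hA : ∀ X Y, form ε (A X) Y + form ε X (A Y) = 0) (hσ : ∀ x ∈ space ε n, σ x = A x)
    {w : ℝ} (hw : 0 < w)
    (hμ : ∀ X, A (A (A X)) = (-w ^ 2) • A X) {τ : Ambient n} (hτ : τ ∈ space ε n)
    (hAτ : A τ = 0) :
    ∃ r : ℕ, Module.finrank ℝ (LinearMap.range A.toLinearMap) = 2 * r ∧ 2 * r < n + 1 ∧
      AreCongruent ε σ (fun x => w • hopfField r x) := by
  obtain ⟨r, f, hr, hrn, hfn, hf0, hf1, hf2, hf⟩ := exists_adapted_frame hε hA hw hμ hτ hAτ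
  have hrn' : 2 * r < n + 1 := by omega
  refine ⟨r, hr, hrn', ?_⟩
  -- T maps the standard basis to the adapted frame, so it preserves the form and intertwines wΣ_r
  -- with A. The congruence is its inverse.
  let T : Ambient n →ₗ[ℝ] Ambient n :=
    ∑ i : Fin (n + 1), (EuclideanSpace.proj i : Ambient n →L[ℝ] ℝ).toLinearMap.smulRight (f i)
  have hT : ∀ y, T y = ∑ i : Fin (n + 1), y i • f i := fun y => by
    simp [T, LinearMap.sum_apply]
  have hTs : ∀ i : Fin (n + 1), T (EuclideanSpace.single i 1) = f i := fun i => by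
    rw [hT]
    simp
  have hTform : ∀ y z, form ε (T y) (T z) = form ε y z := by
    intro y z
    rw [hT, hT, form_sum_left]
    simp only [form_sum_right, form_smul_left, form_smul_right]
    have : ∀ i j : Fin (n + 1), z j * (y i * form ε (f i) (f j)) =
        if i = j then signature ε i * (y i * z i) else 0 := by
      intro i j
      rw [hf i (by omega) j (by omega)]
      by_cases h : i = j
      · subst h
        simp only [if_true, signature, Fin.ext_iff, Fin.val_last]
        split_ifs <;> ring
      · rw [if_neg h, if_neg (fun h' => h (Fin.ext h'))]; ring
    simp only [this, Finset.sum_ite_eq, Finset.mem_univ, if_true]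
    rfl
  have hTinj : Function.Injective T := by
    rw [← LinearMap.ker_eq_bot, LinearMap.ker_eq_bot']
    intro v hv
    refine eq_zero_of_form hε fun y => ?_
    rw [← hTform, hv, form_zero_left]
  let e : Ambient n ≃L[ℝ] Ambient n :=
    (LinearEquiv.ofInjectiveEndo T hTinj).toContinuousLinearEquiv
  have he : ∀ y, e y = T y := fun y => rfl
  have hAT : ∀ y, A (T y) = w • T (hopfField r y) := by
    have : A.toLinearMap ∘ₗ T = w • (T ∘ₗ hopfLinear n r) := by
      refine ext_single fun i => ?_
      simp only [LinearMap.comp_apply, LinearMap.smul_apply, hopfLinear_apply,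
        ContinuousLinearMap.coe_coe, hTs]
      rcases index_cases r hrn' i with ⟨a, ha, rfl⟩ | ⟨a, ha, rfl⟩ | h
      · rw [hopfField_single_even ha hrn', hTs, hf0 a ha]
      · rw [hopfField_single_odd ha hrn', map_neg, hTs, hf1 a ha]
        simp
      · rw [hopfField_single_of_le hrn' i h, hf2 i h, map_zero, smul_zero]
    exact fun y => LinearMap.congr_fun this y
  have hlast : e (EuclideanSpace.single (Fin.last n) 1) = τ := by
    rw [he, hTs, ← hfn]; rfl
  refine ⟨e.symm, isIsometry_of_linear hε e.symm (fun x y => ?_) hτ ?_, fun x hx => ?_⟩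
  · rw [← hTform, ← he, ← he]; simp
  · rw [← hlast, e.symm_apply_apply]
    exact single_last_mem_space
  · have hX : form ε x (σ x) = 0 := by
      rw [hσ x hx, form_comm, form_apply_self hA]
    have hd : dirDeriv ε e.symm x (σ x) = e.symm (σ x) :=
      dirDeriv_linear hε (L := (e.symm : Ambient n →L[ℝ] Ambient n)) (fun _ _ => rfl) hx hX
    rw [hd, hσ x hx]
    apply e.injective
    have h1 := hAT (e.symm x)
    rw [← he, e.apply_symm_apply] at h1
    rw [e.apply_symm_apply, h1, map_smul]
    rfl

/-- By homogeneity the maps agree on the cone, which is open and so determines a linear map. -/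
theorem linear_eq_of_eqOn_space (hε : ε = 1 ∨ ε = -1) (hne : (space ε n).Nonempty)
    {L L' : Ambient n →ₗ[ℝ] Ambient n} (h : ∀ x ∈ space ε n, L x = L' x) : L = L' := by
  obtain ⟨x₀, hx₀⟩ := hne
  have hcone : ∀ y ∈ cone ε n, L y = L' y := fun y hy => by
    rw [← radius_smul_radial hy, map_smul, map_smul, h _ (radial_mem hε hy)]
  ext1 v
  have hcont : Continuous fun t : ℝ => x₀ + t • v := by fun_prop
  have hnear : ∀ᶠ t : ℝ in nhds 0, x₀ + t • v ∈ cone ε n :=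
    hcont.continuousAt.eventually_mem ((isOpen_cone ε).mem_nhds (by
      simpa using space_subset_cone hε hx₀))
  obtain ⟨δ, hδ, hball⟩ := Metric.eventually_nhds_iff.mp hnear
  have e1 := hcone _ (@hball (δ / 2) (by simp [abs_of_pos hδ]; linarith))
  rw [map_add, map_add, h x₀ hx₀, map_smul, map_smul, add_right_inj] at e1
  exact smul_right_injective _ (by positivity : δ / 2 ≠ 0) e1

/-- The algebraic invariants of a Killing field congruent to a twisted Hopf field. -/
theorem cubic_and_trace_of_areCongruent (hε : ε = 1 ∨ ε = -1) (hn : 1 ≤ n)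
    (hne : (space ε n).Nonempty)
    (hA : ∀ X Y, form ε (A X) Y + form ε X (A Y) = 0) (hσ : ∀ x ∈ space ε n, σ x = A x)
    {r : ℕ} (hr : 2 * r < n + 1) {w : ℝ}
    (h : AreCongruent ε σ (fun x => w • hopfField r x)) :
    (∀ X, A (A (A X)) = (-w ^ 2) • A X) ∧
      LinearMap.trace ℝ (Ambient n) (A * A).toLinearMap = -(2 * r * w ^ 2) := by
  obtain ⟨φ, hφ, hcong⟩ := h
  obtain ⟨L, hLφ, hLform⟩ := hφ.exists_linear hε hn
  replace hLform := hLform hne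
  have hinj : Function.Injective L.toLinearMap := by
    rw [← LinearMap.ker_eq_bot, LinearMap.ker_eq_bot']
    intro v hv
    refine eq_zero_of_form hε fun y => ?_
    have hv' : L v = 0 := hv
    rw [← hLform, hv', form_zero_left]
  have hLA : L.toLinearMap ∘ₗ A.toLinearMap = w • (hopfLinear n r ∘ₗ L.toLinearMap) := by
    refine linear_eq_of_eqOn_space hε hne fun x hx => ?_
    have hX : form ε x (σ x) = 0 := by
      rw [hσ x hx, form_comm, form_apply_self hA]
    have := hcong x hx
    rw [dirDeriv_linear hε hLφ hx hX, hσ x hx, hLφ x hx] at this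
    exact this
  have hLA' : ∀ x, L (A x) = w • hopfLinear n r (L x) := fun x => LinearMap.congr_fun hLA x
  constructor
  · intro X
    apply hinj
    change L (A (A (A X))) = L ((-w ^ 2) • A X)
    rw [hLA', hLA', hLA', map_smul L, hLA']
    simp only [map_smul, hopfLinear_cubic hr]
    module
  · let e := LinearEquiv.ofInjectiveEndo L.toLinearMap hinj
    have he : e.conj (A * A).toLinearMap = (w ^ 2) • (hopfLinear n r ∘ₗ hopfLinear n r) := by
      ext1 y
      obtain ⟨x, rfl⟩ := e.surjective y
      rw [LinearEquiv.conj_apply_apply, e.symm_apply_apply]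
      change L (A (A x)) = (w ^ 2) • hopfLinear n r (hopfLinear n r (L x))
      rw [hLA', hLA', map_smul]
      module
    rw [← LinearMap.trace_conj' _ e, he, map_smul, trace_hopfLinear_sq hr, smul_eq_mul]
    ring

end Linear

/-! ### The twist equation -/

/-- In the variable t² the equation is quadratic, or linear if a = 0. Two distinct positive roots
would have product -c/a < 0. -/
theorem existsUnique_pos_root {a b c : ℝ} (ha : 0 ≤ a) (hc : 0 < c) (h : a ≠ 0 ∨ 0 < b) :
    ∃! t : ℝ, 0 < t ∧ a * t ^ 4 + b * t ^ 2 - c = 0 := by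
  have hex : ∃ u : ℝ, 0 < u ∧ a * u ^ 2 + b * u - c = 0 := by
    rcases ha.eq_or_lt' with h0 | h0
    · have hb := h.resolve_left (fun h' => h' h0)
      exact ⟨c / b, by positivity, by rw [h0]; field_simp; ring⟩
    · have hD : 0 ≤ b ^ 2 + 4 * a * c := by positivity
      have hs := Real.sq_sqrt hD
      have hlt : b < √(b ^ 2 + 4 * a * c) := by
        apply Real.lt_sqrt_of_sq_lt
        have : 0 < 4 * a * c := by positivity
        linarith
      refine ⟨(-b + √(b ^ 2 + 4 * a * c)) / (2 * a), div_pos (by linarith) (by linarith), ?_⟩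
      set D := √(b ^ 2 + 4 * a * c)
      have h2a : a * ((-b + D) / (2 * a)) ^ 2 + b * ((-b + D) / (2 * a)) - c =
          (D ^ 2 - (b ^ 2 + 4 * a * c)) / (4 * a) := by field_simp; ring
      rw [h2a, hs, sub_self, zero_div]
  obtain ⟨u, hu, hroot⟩ := hex
  refine ⟨√u, ⟨Real.sqrt_pos.mpr hu, ?_⟩, ?_⟩
  · have h1 := Real.sq_sqrt hu.le
    have h2 : √u ^ 4 = u ^ 2 := by rw [← h1]; ring_nf; rw [Real.sqrt_sq (Real.sqrt_nonneg u)]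
    rw [h1, h2]; exact hroot
  · rintro t ⟨ht, htr⟩
    have h1 : (t ^ 2 - u) * (a * (t ^ 2 + u) + b) = 0 := by linear_combination htr - hroot
    rcases mul_eq_zero.mp h1 with h2 | h2
    · rw [← Real.sqrt_sq ht.le]
      congr 1; linarith
    · exfalso
      have h3 : -(a * (t ^ 2 * u)) = c := by linear_combination (-t ^ 2) * h2 + htr
      have : 0 ≤ a * (t ^ 2 * u) := by positivity
      linarith

theorem existsUnique_isOptimalTwist {ε : ℝ} (hε : ε = 1 ∨ ε = -1) (hn : 2 ≤ n) {r : ℕ}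
    (hr : IsAdmissibleRank ε n r) : ∃! w : ℝ, IsOptimalTwist ε n r w := by
  obtain ⟨h0, h1, h2⟩ := hr
  have hn' : (2 : ℝ) ≤ n := by exact_mod_cast hn
  have h0' : (1 : ℝ) ≤ r := by exact_mod_cast h0
  have h1' : 2 * (r : ℝ) < n + 1 := by exact_mod_cast h1
  have := existsUnique_pos_root (a := 2 * ((n : ℝ) + 1 - 2 * r) * ((r : ℝ) - 1))
    (b := ε * (2 * n * ((r : ℝ) - 1) - ((n : ℝ) + 1 - 2 * r))) (c := n - 1)
    (mul_nonneg (by linarith) (by linarith)) (by linarith) (by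
      -- For r = 1 the leading coefficient vanishes; admissibility then forces ε = -1, and the
      -- middle coefficient is n - 1 > 0.
      by_cases hr1 : r = 1
      · right
        have hε' : ε = -1 := hε.resolve_left fun h => by have := h2 h; omega
        rw [hε', hr1]
        push_cast
        linarith
      · left
        have : (2 : ℝ) ≤ r := by exact_mod_cast (by omega : 2 ≤ r)
        exact (mul_pos (by linarith) (by linarith)).ne')
  obtain ⟨t, ht, hu⟩ := this
  refine ⟨t, ⟨ht.1, by linear_combination ht.2⟩, fun y hy => hu y ⟨hy.1, ?_⟩⟩
  linear_combination hy.2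

/-- At w² = -ε the twist polynomial has the value -4r(r-1), nonzero for r > 1. This justifies the
denominator in q. -/
theorem sq_add_ne_zero_of_isOptimalTwist {ε : ℝ} (hε : ε = 1 ∨ ε = -1) {r : ℕ}
    (h1 : 1 < r) {w : ℝ} (hw : IsOptimalTwist ε n r w) : w ^ 2 + ε ≠ 0 := by
  intro h
  have h1' : (1 : ℝ) < r := by exact_mod_cast h1
  have h2 : w ^ 2 = -ε := by linarith
  have h3 : w ^ 4 = 1 := by
    rw [show w ^ 4 = (w ^ 2) ^ 2 by ring, h2]
    linear_combination sq_eq_one hε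
  have h4 := hw.2
  rw [h2, h3] at h4
  have h5 : -4 * (r : ℝ) * (r - 1) = 0 := by
    linear_combination h4 + (2 * n * ((r : ℝ) - 1) - ((n : ℝ) + 1 - 2 * r)) * sq_eq_one hε
  have : 0 < (r : ℝ) * (r - 1) := mul_pos (by linarith) (by linarith)
  linarith

/-- The twist equation is what makes the coefficient equations compatible. -/
theorem coeff_equations_iff {ε : ℝ} (hε : ε = 1 ∨ ε = -1) (hn : 2 ≤ n) {r : ℕ}
    (hr : IsAdmissibleRank ε n r) {w : ℝ} (hw : IsOptimalTwist ε n r w) (p q : ℝ) :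
    (q * (n + 1 - p) = 0 ∧
      ε * (n - 1) - p * q * (-w ^ 2) + q * (ε * (n + 1) - 2 * r * w ^ 2) = 0 ∧
      ε * (n - 1) - p * (2 * r * w ^ 2) - q * (2 * r * w ^ 2) - 2 * p * (-w ^ 2) = 0) ↔
    p = n + 1 ∧ q = metricParameterQ ε n r w := by
  have he := sq_eq_one hε
  have hn' : (2 : ℝ) ≤ n := by exact_mod_cast hn
  have hε0 : ε ≠ 0 := by rcases hε with rfl | rfl <;> norm_num
  have hw0 := hw.1
  have htw := hw.2
  have hr0 : (0 : ℝ) < r := by exact_mod_cast hr.1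
  have hp : ∀ p q : ℝ, q * (n + 1 - p) = 0 →
      ε * (n - 1) - p * q * (-w ^ 2) + q * (ε * (n + 1) - 2 * r * w ^ 2) = 0 → p = n + 1 := by
    intro p q h2 h1
    rcases mul_eq_zero.mp h2 with h | h
    · exfalso
      rw [h] at h1
      have : ε * ((n : ℝ) - 1) = 0 := by linear_combination h1
      rcases mul_eq_zero.mp this with h' | h'
      · exact hε0 h'
      · linarith
    · linarith
  by_cases h1 : r = 1
  · subst h1
    have hw2 : w ^ 2 = -ε := by
      have : ((n : ℝ) - 1) * (w ^ 2 + ε) = 0 := by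
        push_cast at htw
        linear_combination (-ε) * htw - (n - 1) * w ^ 2 * he
      have := (mul_eq_zero.mp this).resolve_left (by linarith)
      linarith
    rw [metricParameterQ, if_pos rfl, hw2]
    push_cast
    constructor
    · rintro ⟨h2, h1, h0⟩
      rw [← hw2] at h1
      refine ⟨hp p q h2 (by push_cast; linear_combination h1), ?_⟩
      -- At w² = -ε the terms in p cancel in the third equation, leaving ε(n-1) + 2εq = 0.
      linear_combination (ε / 2) * h0 + (-((n : ℝ) - 1) / 2 - q) * he
    · rintro ⟨rfl, rfl⟩
      refine ⟨by ring, ?_, ?_⟩ <;> ring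
  · have h1r : 1 < r := by have := hr.1; omega
    have hne := sq_add_ne_zero_of_isOptimalTwist hε h1r hw
    rw [metricParameterQ, if_neg h1]
    constructor
    · rintro ⟨h2, h1, h0⟩
      have hpn := hp p q h2 h1
      refine ⟨hpn, ?_⟩
      subst hpn
      rw [← mul_div_assoc, eq_div_iff hne]
      have hrw : 2 * (r : ℝ) * w ^ 2 ≠ 0 := by positivity
      apply mul_left_cancel₀ hrw
      -- The third equation alone determines q when p = n + 1; the twist equation brings the answer
      -- to the stated form.
      linear_combination (-(w ^ 2 + ε)) * h0 - htw + (n - 1) * he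
    · rintro ⟨rfl, hq⟩
      rw [← mul_div_assoc, eq_div_iff hne] at hq
      refine ⟨by ring, ?_, ?_⟩
      · apply (mul_eq_zero.mp (?_ : (w ^ 2 + ε) * _ = 0)).resolve_left hne
        linear_combination (ε * (n + 1) + (n + 1 - 2 * r) * w ^ 2) * hq - htw + (n - 1) * he
      · apply (mul_eq_zero.mp (?_ : (w ^ 2 + ε) * _ = 0)).resolve_left hne
        linear_combination (-2 * r * w ^ 2) * hq - htw + (n - 1) * he

section Linear

variable {ε : ℝ} {A : Ambient n →L[ℝ] Ambient n} {σ : Ambient n → Ambient n}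

/-! ### Classification of harmonic Killing fields -/

/-- μ⁻¹A² is a projection onto the range of A, and the trace of a projection is its rank. -/
theorem trace_sq_of_cubic {μ : ℝ} (hμ0 : μ ≠ 0) (hμ : ∀ X, A (A (A X)) = μ • A X) :
    LinearMap.trace ℝ (Ambient n) (A * A).toLinearMap =
      μ * Module.finrank ℝ (LinearMap.range A.toLinearMap) := by
  have hP : LinearMap.IsProj (LinearMap.range A.toLinearMap) (μ⁻¹ • (A * A).toLinearMap) := by
    refine ⟨fun x => Submodule.smul_mem _ _ ⟨A x, rfl⟩, ?_⟩
    rintro _ ⟨v, rfl⟩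
    change μ⁻¹ • A (A (A v)) = A v
    rw [hμ, smul_smul, inv_mul_cancel₀ hμ0, one_smul]
  have := hP.trace
  rw [map_smul, smul_eq_mul] at this
  rw [← this, mul_inv_cancel_left₀ hμ0]

theorem trace_sq_of_cubic_zero (hμ : ∀ X, A (A (A X)) = (0 : ℝ) • A X) :
    LinearMap.trace ℝ (Ambient n) (A * A).toLinearMap = 0 := by
  apply IsNilpotent.eq_zero
  apply LinearMap.isNilpotent_trace_of_isNilpotent
  refine ⟨2, ?_⟩
  ext1 x
  change A (A (A (A x))) = 0
  rw [hμ, zero_smul]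

/-- Hyperbolic Killing fields have rank two. -/
theorem finrank_range_le_two (hA : ∀ X Y, form ε (A X) Y + form ε X (A Y) = 0)
    {μ : ℝ} (hμ0 : 0 < μ) (hμ : ∀ X, A (A (A X)) = μ • A X) :
    Module.finrank ℝ (LinearMap.range A.toLinearMap) ≤ 2 := by
  by_contra hlt
  let l : Ambient n →ₗ[ℝ] ℝ := (EuclideanSpace.proj (Fin.last n) : Ambient n →L[ℝ] ℝ).toLinearMap
  let W := LinearMap.range A.toLinearMap
  -- Rank above two leaves a nonzero u in the range with both u and Au free of the last coordinate.
  -- Then ⟨u, u⟩ > 0 and ⟨Au, Au⟩ ≥ 0, against ⟨Au, Au⟩ = -μ⟨u, u⟩.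
  let m : W →ₗ[ℝ] ℝ × ℝ := (l.prod (l ∘ₗ A.toLinearMap)).domRestrict W
  have hker : LinearMap.ker m ≠ ⊥ := by
    apply LinearMap.ker_ne_bot_of_finrank_lt
    rw [Module.finrank_prod, Module.finrank_self]
    exact not_le.mp hlt
  obtain ⟨u, hu, hu0⟩ := Submodule.exists_mem_ne_zero_of_ne_bot hker
  have hm : m u = 0 := hu
  have h1 : (u : Ambient n) (Fin.last n) = 0 := congrArg Prod.fst hm
  have h2 : A u (Fin.last n) = 0 := congrArg Prod.snd hm
  have hu0' : (u : Ambient n) ≠ 0 := fun h => hu0 (Subtype.ext h)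
  have h3 := form_self_pos_of_last (ε := ε) h1 hu0'
  have h4 : 0 ≤ form ε (A u) (A u) := by
    by_cases h : A u = 0
    · simp [h]
    · exact (form_self_pos_of_last h2 h).le
  obtain ⟨_, v, rfl⟩ := u
  have h5 := form_apply_apply hA hμ v
  have h6 : form ε (A (A v)) (A (A v)) = -(μ * form ε (A v) (A v)) := by rw [h5]; ring
  have h7 : 0 < μ * form ε (A v) (A v) := mul_pos hμ0 h3
  have h8 : 0 ≤ form ε (A (A v)) (A (A v)) := h4
  linarith

/-- An elliptic Killing field of non-constant length has a zero. -/
theorem exists_zero_of_elliptic (hε : ε = 1 ∨ ε = -1)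
    (hA : ∀ X Y, form ε (A X) Y + form ε X (A Y) = 0) (hσ : ∀ x ∈ space ε n, σ x = A x)
    (hc : ¬ HasConstantLength ε σ) {w : ℝ} (hw : 0 < w)
    (hμ : ∀ X, A (A (A X)) = (-w ^ 2) • A X) : ∃ τ ∈ space ε n, A τ = 0 := by
  suffices h : ∃ v ∈ cone ε n, A v = 0 by
    obtain ⟨v, hv, hAv⟩ := h
    exact ⟨radial ε v, radial_mem hε hv, by rw [radial_eq, map_smul, hAv, smul_zero]⟩
  -- The map v ↦ v + w⁻²A²v is the projection onto ker A along the range.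
  have hker : ∀ v, A (v + (w ^ 2)⁻¹ • A (A v)) = 0 := fun v => by
    rw [map_add, map_smul, hμ, smul_smul]
    have : (w ^ 2)⁻¹ * -w ^ 2 = -1 := by field_simp
    rw [this]
    simp
  rcases hε with rfl | rfl
  -- On the sphere, absence of zeros means ker A = 0, so A² = -w² and |Ax|² = w² is constant.
  · by_contra hno
    have hzero : ∀ v, A v = 0 → v = 0 := fun v hv => by
      by_contra h0
      exact hno ⟨v, ⟨by simpa using form_one_self_pos h0, fun h => by norm_num at h⟩, hv⟩
    apply hc
    refine ⟨w ^ 2, fun x hx => ?_⟩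
    have h1 := hzero _ (hker x)
    have h2 : form 1 x (x + (w ^ 2)⁻¹ • A (A x)) = 0 := by rw [h1]; simp
    rw [form_add_right, form_smul_right, hx.1, form_apply_swap hA] at h2
    rw [lengthSq_linear hσ hx]
    field_simp at h2
    linarith
  -- In the hyperbolic case the projection v of the base point e satisfies ⟨v, v⟩ = ⟨v, e⟩ ≤ -1, so
  -- it is timelike and future pointing.
  · set e : Ambient n := EuclideanSpace.single (Fin.last n) (1 : ℝ) with he
    have hem : e ∈ space (-1) n := single_last_mem_space
    refine ⟨_, ?_, hker e⟩
    set v := e + (w ^ 2)⁻¹ • A (A e) with hv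
    have hpos : 0 ≤ form (-1) (A e) (A e) := by
      by_cases h : A e = 0
      · simp [h]
      · have ht : form (-1) e (A e) = 0 := by rw [form_comm, form_apply_self hA]
        exact (form_self_pos_of_tangent (Or.inr rfl) hem ht h).le
    have hve : form (-1) v e = -1 - (w ^ 2)⁻¹ * form (-1) (A e) (A e) := by
      rw [hv, form_add_left, form_smul_left, hem.1, form_comm (-1) (A (A e)), form_apply_swap hA]
      ring
    have hvv : form (-1) v v = form (-1) v e := by
      conv_lhs => rw [hv, form_add_right, ← hv, form_smul_right, form_apply_swap hA, hker]
      simp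
    have hneg : form (-1) v e < 0 := by
      rw [hve]
      have : 0 ≤ (w ^ 2)⁻¹ * form (-1) (A e) (A e) := by positivity
      linarith
    refine ⟨by rw [hvv]; linarith, fun _ => ?_⟩
    rw [he, form_single] at hneg
    simpa [signature] using hneg

/-- In the Euler-Lagrange equation of a harmonic Killing field the eigenvalue is negative. -/
theorem eigenvalue_neg (hε : ε = 1 ∨ ε = -1) (hn : 2 ≤ n)
    (hA : ∀ X Y, form ε (A X) Y + form ε X (A Y) = 0) (hσ : ∀ x ∈ space ε n, σ x = A x)
    (hc : ¬ HasConstantLength ε σ) {μ : ℝ} (hμ : ∀ X, A (A (A X)) = μ • A X)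
    {p q : ℝ} (h : IsPQHarmonic ε p q σ) : μ < 0 := by
  have hn' : (2 : ℝ) ≤ n := by exact_mod_cast hn
  have hεn : ε * ((n : ℝ) - 1) ≠ 0 := by
    rcases hε with rfl | rfl
    · have : (1 : ℝ) * (n - 1) > 0 := by linarith
      exact this.ne'
    · have : (-1 : ℝ) * (n - 1) < 0 := by linarith
      exact this.ne
  rcases lt_trichotomy μ 0 with hlt | rfl | hgt
  · exact hlt
  · exfalso
    obtain ⟨-, -, h0⟩ := (isPQHarmonic_iff hε hn hA hσ hc hμ (s := 0)
      (by rw [trace_sq_of_cubic_zero hμ, neg_zero]) p q).mp h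
    apply hεn
    linear_combination h0
  · exfalso
    rcases hε with rfl | rfl
    · apply hc
      refine ⟨0, fun x hx => ?_⟩
      rw [lengthSq_linear hσ hx]
      by_contra h0
      have h1 : A x ≠ 0 := fun h1 => h0 (by simp [h1])
      have h2 := form_one_self_pos h1
      have h3 := form_apply_apply hA hμ x
      have h4 : 0 ≤ form 1 (A (A x)) (A (A x)) := by
        by_cases h : A (A x) = 0
        · simp [h]
        · exact (form_one_self_pos h).le
      have h5 : 0 < μ * form 1 (A x) (A x) := mul_pos hgt h2
      linarith
    · have hR := finrank_range_le_two hA hgt hμ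
      have hs := trace_sq_of_cubic hgt.ne' hμ
      set R := Module.finrank ℝ (LinearMap.range A.toLinearMap)
      have hR' : (R : ℝ) ≤ 2 := by exact_mod_cast hR
      have hR0 : (0 : ℝ) ≤ R := by positivity
      obtain ⟨h2, h1, h0⟩ := (isPQHarmonic_iff (Or.inr rfl) hn hA hσ hc hμ (s := -(μ * R))
        (by rw [hs, neg_neg]) p q).mp h
      have hq : q ≠ 0 := by
        rintro rfl
        apply hεn
        linear_combination h1
      have hp : p = n + 1 := by
        have := (mul_eq_zero.mp h2).resolve_left hq
        linarith
      subst hp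
      have hpos : 0 < ((n : ℝ) + 1 - R) * μ + (n + 1) := by
        have : 0 ≤ ((n : ℝ) + 1 - R) * μ := mul_nonneg (by linarith) hgt.le
        linarith
      -- With rank R ≤ 2, tr A² = μR and p = n+1, the second equation forces q < 0. The third then
      -- reads -(n-1) - (n+1)μ(2-R) + qμR = 0, a sum of nonpositive terms with the first one
      -- negative.
      have hqneg : q < 0 := by
        by_contra hq0
        have : 0 ≤ q * (((n : ℝ) + 1 - R) * μ + (n + 1)) := mul_nonneg (not_lt.mp hq0) hpos.le
        linarith
      have e1 : 0 ≤ (n + 1) * μ * (2 - R) :=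
        mul_nonneg (mul_nonneg (by linarith) hgt.le) (by linarith)
      have e2 : 0 ≤ -q * (μ * R) := mul_nonneg (by linarith) (mul_nonneg hgt.le hR0)
      linarith

/-- A harmonic Killing field of non-constant length is congruent to an optimally twisted
generalised Hopf field. -/
theorem exists_congruent_of_isPQHarmonic (hε : ε = 1 ∨ ε = -1) (hn : 2 ≤ n)
    (hA : ∀ X Y, form ε (A X) Y + form ε X (A Y) = 0) (hσ : ∀ x ∈ space ε n, σ x = A x)
    (hc : ¬ HasConstantLength ε σ) {p q : ℝ} (h : IsPQHarmonic ε p q σ) :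
    ∃ (r : ℕ) (w : ℝ), IsAdmissibleRank ε n r ∧ IsOptimalTwist ε n r w ∧
      AreCongruent ε σ (fun x => w • hopfField r x) := by
  have he := sq_eq_one hε
  have hn' : (2 : ℝ) ≤ n := by exact_mod_cast hn
  obtain ⟨μ, hμ⟩ := exists_cubic hε hn hA hσ hc h
  have hneg := eigenvalue_neg hε hn hA hσ hc hμ h
  obtain ⟨w, hw, rfl⟩ : ∃ w : ℝ, 0 < w ∧ μ = -w ^ 2 :=
    ⟨√(-μ), Real.sqrt_pos.mpr (by linarith), by rw [Real.sq_sqrt (by linarith)]; ring⟩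
  obtain ⟨τ, hτ, hAτ⟩ := exists_zero_of_elliptic hε hA hσ hc hw hμ
  obtain ⟨r, hr, hrn, hcong⟩ := exists_areCongruent hε hA hσ hw hμ hτ hAτ
  have hs := trace_sq_of_cubic hneg.ne hμ
  rw [hr] at hs
  rw [Nat.cast_mul, Nat.cast_ofNat] at hs
  obtain ⟨h2, h1, h0⟩ := (isPQHarmonic_iff hε hn hA hσ hc hμ (s := 2 * r * w ^ 2)
    (by rw [hs]; ring) p q).mp h
  have hεn : ε * ((n : ℝ) - 1) ≠ 0 := by
    intro h
    have : (n : ℝ) - 1 = 0 := by linear_combination ε * h - (n - 1) * he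
    linarith
  have hr0 : 0 < r := by
    by_contra hr0
    have hr0 : r = 0 := by omega
    rw [hr0, mul_zero, Submodule.finrank_eq_zero, LinearMap.range_eq_bot] at hr
    apply hc
    refine ⟨0, fun x hx => ?_⟩
    have : A x = 0 := LinearMap.congr_fun hr x
    rw [lengthSq_linear hσ hx, this]; simp
  have hq : q ≠ 0 := by
    rintro rfl
    apply hεn
    linear_combination h1
  have hp : p = n + 1 := by
    have := (mul_eq_zero.mp h2).resolve_left hq
    linarith
  subst hp
  refine ⟨r, w, ⟨hr0, hrn, fun hε1 => ?_⟩, ⟨hw, ?_⟩, hcong⟩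
  -- On the sphere with r = 1 the third equation says 2qw² = n - 1, so q > 0, and then every term of
  -- the second equation is positive.
  · by_contra hr1
    have hr1 : r = 1 := by omega
    subst hr1
    subst hε1
    push_cast at h0 h1
    have hw2 : 0 < w ^ 2 := by positivity
    have hqw : 2 * q * w ^ 2 = n - 1 := by linear_combination -h0
    have hq0 : 0 < q := by
      by_contra hq0
      have : 0 ≤ -q * w ^ 2 := mul_nonneg (by linarith) hw2.le
      linarith
    have e1 : 0 < q * (((n : ℝ) - 1) * w ^ 2 + (n + 1)) :=
      mul_pos hq0 (add_pos (mul_pos (by linarith) hw2) (by linarith))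
    linarith
  · have hn1 : (n : ℝ) + 1 ≠ 0 := by positivity
    apply (mul_eq_zero.mp (?_ : ((n : ℝ) + 1) * _ = 0)).resolve_left hn1
    -- The multipliers are, up to sign, the coefficients of q in the third and second equations.
    -- They eliminate q and leave n + 1 times the twist equation.
    linear_combination (-2 * r * w ^ 2) * h1
      - ((n + 1 - 2 * r) * w ^ 2 + ε * (n + 1)) * h0 + (n + 1) * (n - 1) * he

end Linear

end SpaceForm

end

/-! ### The theorem -/

open SpaceForm
theorem theorem3p7 (n : ℕ) (hn : 2 ≤ n) (ε : ℝ) (hε : ε = 1 ∨ ε = -1) :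
    (∀ r : ℕ, IsAdmissibleRank ε n r → ∃! ω₀ : ℝ, IsOptimalTwist ε n r ω₀) ∧
    ∀ σ : Ambient n → Ambient n, IsKilling ε σ → ¬ HasConstantLength ε σ →
      (IsHarmonic ε σ ↔
        ∃ (r : ℕ) (ω₀ : ℝ), IsAdmissibleRank ε n r ∧ IsOptimalTwist ε n r ω₀ ∧
          AreCongruent ε σ (fun x => ω₀ • hopfField r x)) ∧
      (∀ (r : ℕ) (ω₀ : ℝ), IsAdmissibleRank ε n r → IsOptimalTwist ε n r ω₀ →
          AreCongruent ε σ (fun x => ω₀ • hopfField r x) →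
        ∀ p q : ℝ, IsPQHarmonic ε p q σ ↔ p = (n : ℝ) + 1 ∧ q = metricParameterQ ε n r ω₀) := by
  refine ⟨fun r hr => existsUnique_isOptimalTwist hε hn hr, fun σ hK hc => ?_⟩
  obtain ⟨A, hσ, hA⟩ := hK.exists_linear hε (by omega)
  have hne : (space ε n).Nonempty := ⟨_, single_last_mem_space⟩
  replace hA := hA hne
  have hunique : ∀ (r : ℕ) (ω₀ : ℝ), IsAdmissibleRank ε n r → IsOptimalTwist ε n r ω₀ →
      AreCongruent ε σ (fun x => ω₀ • hopfField r x) →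
      ∀ p q : ℝ, IsPQHarmonic ε p q σ ↔
        p = (n : ℝ) + 1 ∧ q = metricParameterQ ε n r ω₀ := by
    intro r w hr hw hcong p q
    obtain ⟨hμ, hs⟩ := cubic_and_trace_of_areCongruent hε (by omega) hne hA hσ hr.2.1 hcong
    rw [isPQHarmonic_iff hε hn hA hσ hc hμ hs]
    exact coeff_equations_iff hε hn hr hw p q
  refine ⟨⟨?_, ?_⟩, hunique⟩
  · rintro ⟨p, q, h⟩
    exact exists_congruent_of_isPQHarmonic hε hn hA hσ hc h
  · rintro ⟨r, w, hr, hw, hcong⟩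
    exact ⟨_, _, (hunique r w hr hw hcong _ _).mpr ⟨rfl, rfl⟩⟩
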